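/- Let $R$ and $S$ be associative rings with identity and let ${}_RC_S$ be a semidualizing bimodule, that is: ${}_RC$ and $C_S$ have resolutions by finitely generated projective modules, the homothety maps $R\to\operatorname{Hom}_{S^{op}}(C,C)$ and $S\to\operatorname{Hom}_R(C,C)$ are isomorphisms, and $\operatorname{Ext}_R^{i}(C,C)=0=\operatorname{Ext}_{S^{op}}^{i}(C,C)$ for all $i\ge 1$. Let $\mathcal{A}_C(S)$ be the Auslander class, i.e. the class of left $S$-modules $N$ such that $\operatorname{Tor}^S_{i}(C,N)=0$ and $\operatorname{Ext}_R^{i}(C,C\otimes_SN)=0$ for all $i\geq 1$, and the canonical map $N\to\operatorname{Hom}_R(C,C\otimes_SN)$, $x\mapsto(c\mapsto c\otimes x)$, is an isomorphism. Let $\mathcal{I}_C(S)$ be the class of left $S$-modules isomorphic to $\operatorname{Hom}_R(C,I)$ for some injective left $R$-module $I$. For a class $\mathcal{X}$ of left $S$-modules, $\mathcal{X}\text{-}\mathrm{pd}\,N$ is the infimum of all $n\ge 0$ for which there is an exact sequence $0\to X_n\to\cdots\to X_0\to N\to 0$ with all $X_i\in\mathcal{X}$ ($\infty$ if there is none); by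 convention, $\mathcal{X}\text{-}\mathrm{pd}\,N\le -1$ means $N=0$. Let $N$ be a left $S$-module with $\mathcal{A}_C(S)\text{-}\mathrm{pd}\,N<\infty$ and let $n\ge 0$. Then the following statements are equivalent. 1. $\mathcal{A}_C(S)\text{-}\mathrm{pd}\,N\le n$. 2. $\Omega^n(N)\in\mathcal{A}_C(S)$ for some $n$-th syzygy $\Omega^n(N)$ of $N$ (formed with projective modules, $\Omega^0(N)=N$); equivalently, for every $n$-th syzygy of $N$. 3. $\operatorname{Tor}^S_{i}(C,N)=0$ for all $i\ge n+1$. 4. There is an exact sequence $0\to H\to A\to N\to 0$ of left $S$-modules with $A\in\mathcal{A}_C(S)$ and $\mathcal{I}_C(S)\text{-}\mathrm{pd}\,H\le n-1$. 5. There is an exact sequence $0\to N\to H'\to A'\to 0$ of left $S$-modules with $A'\in\mathcal{A}_C(S)$ and $\mathcal{I}_C(S)\text{-}\mathrm{pd}\,H'\le n$. 6. There is a sequence as in 5 which moreover stays exact under $\operatorname{Hom}_S(-,U)$ for every $U\in\mathcal{I}_C(S)$. -/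

import Mathlib

open CategoryTheory MulOpposite
open scoped TensorProduct

universe u

namespace AuslanderClass

section Tensor

/- An `(R, S)`-bimodule `C` is an abelian group that is a left `R`-module and a right `S`-module
(a module over `Sᵐᵒᵖ`), the two actions commuting. The product `c * s` is written `op s • c`. -/
variable (R S C : Type u) [Ring R] [Ring S] [AddCommGroup C] [Module R C] [Module Sᵐᵒᵖ C]
  [SMulCommClass R Sᵐᵒᵖ C]
variable (N : Type u) [AddCommGroup N] [Module S N]

/-- The elements `(c * s) ⊗ x - c ⊗ (s * x)` of `C ⊗_ℤ N`. -/
def balancedRel : Set (C ⊗[ℤ] N) :=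
  {z | ∃ (c : C) (s : S) (x : N), z = (op s • c) ⊗ₜ[ℤ] x - c ⊗ₜ[ℤ] (s • x)}

/-- The additive subgroup of `C ⊗_ℤ N` generated by the elements `(c * s) ⊗ x - c ⊗ (s * x)`;
it is stable under the action of `R` on `C`. -/
def balancedSubmodule : Submodule R (C ⊗[ℤ] N) :=
  { AddSubgroup.closure (balancedRel S C N) with
    smul_mem' := by
      intro r z hz
      change z ∈ AddSubgroup.closure (balancedRel S C N) at hz
      change r • z ∈ AddSubgroup.closure (balancedRel S C N)
      induction hz using AddSubgroup.closure_induction with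
      | mem z hz =>
        obtain ⟨c, s, x, rfl⟩ := hz
        refine AddSubgroup.subset_closure ⟨r • c, s, x, ?_⟩
        rw [smul_sub, TensorProduct.smul_tmul', TensorProduct.smul_tmul', smul_comm r (op s) c]
      | zero => rw [smul_zero]; exact zero_mem _
      | add a b _ _ ha hb => rw [smul_add]; exact add_mem ha hb
      | neg a _ ha => rw [smul_neg]; exact neg_mem ha }

/-- The tensor product `C ⊗_S N` over the (possibly noncommutative) ring `S`. -/
def BTensor : Type u := (C ⊗[ℤ] N) ⧸ balancedSubmodule R S C N

instance : AddCommGroup (BTensor R S C N) :=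
  inferInstanceAs (AddCommGroup ((C ⊗[ℤ] N) ⧸ balancedSubmodule R S C N))

/-- `C ⊗_S N` is a left `R`-module through the left action of `R` on `C`. -/
instance : Module R (BTensor R S C N) :=
  inferInstanceAs (Module R ((C ⊗[ℤ] N) ⧸ balancedSubmodule R S C N))

variable {N}

/-- The element `c ⊗ x` of `C ⊗_S N`. -/
def btmul (c : C) (x : N) : BTensor R S C N :=
  (balancedSubmodule R S C N).mkQ (c ⊗ₜ[ℤ] x)

variable {S C} in
lemma btmul_smul (c : C) (s : S) (x : N) :
    btmul R S C (op s • c) x = btmul R S C c (s • x) :=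
  (Submodule.Quotient.eq _).2 (AddSubgroup.subset_closure ⟨c, s, x, rfl⟩)

variable {R S C} in
lemma BTensor.hom_ext {M : Type*} [AddCommGroup M] [Module R M]
    {f g : BTensor R S C N →ₗ[R] M} (h : ∀ c x, f (btmul R S C c x) = g (btmul R S C c x)) :
    f = g := by
  refine Submodule.linearMap_qext (balancedSubmodule R S C N) (LinearMap.ext fun z => ?_)
  induction z using TensorProduct.induction_on with
  | zero => rw [map_zero, map_zero]
  | tmul c x => exact h c x
  | add a b ha hb => rw [map_add, map_add, ha, hb]

/-- The map `C ⊗_S f : C ⊗_S N → C ⊗_S N'`, `c ⊗ x ↦ c ⊗ f x`. -/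
def BTensor.map {N' : Type u} [AddCommGroup N'] [Module S N'] (f : N →ₗ[S] N') :
    BTensor R S C N →ₗ[R] BTensor R S C N' :=
  Submodule.mapQ (balancedSubmodule R S C N) (balancedSubmodule R S C N')
    (TensorProduct.AlgebraTensorModule.lTensor R C f.toAddMonoidHom.toIntLinearMap) (by
      intro z hz
      change z ∈ AddSubgroup.closure (balancedRel S C N) at hz
      rw [Submodule.mem_comap]
      induction hz using AddSubgroup.closure_induction with
      | mem z hz =>
        obtain ⟨c, s, x, rfl⟩ := hz
        exact AddSubgroup.subset_closure ⟨c, s, f x, by simp⟩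
      | zero => rw [map_zero]; exact zero_mem _
      | add a b _ _ ha hb => rw [map_add]; exact add_mem ha hb
      | neg a _ ha => rw [map_neg]; exact neg_mem ha)

@[simp]
lemma BTensor.map_btmul {N' : Type u} [AddCommGroup N'] [Module S N'] (f : N →ₗ[S] N')
    (c : C) (x : N) : BTensor.map R S C f (btmul R S C c x) = btmul R S C c (f x) := rfl

lemma btmul_add (c : C) (x y : N) :
    btmul R S C c (x + y) = btmul R S C c x + btmul R S C c y :=
  (congrArg (balancedSubmodule R S C N).mkQ (TensorProduct.tmul_add c x y)).trans
    (map_add (balancedSubmodule R S C N).mkQ _ _)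

lemma add_btmul (c d : C) (x : N) :
    btmul R S C (c + d) x = btmul R S C c x + btmul R S C d x :=
  (congrArg (balancedSubmodule R S C N).mkQ (TensorProduct.add_tmul c d x)).trans
    (map_add (balancedSubmodule R S C N).mkQ _ _)

lemma smul_btmul (r : R) (c : C) (x : N) :
    btmul R S C (r • c) x = r • btmul R S C c x := rfl

/-- The functor `C ⊗_S - : Mod S ⥤ Mod R`. -/
def tensorFunctor : ModuleCat.{u} S ⥤ ModuleCat.{u} R where
  obj N := ModuleCat.of R (BTensor R S C N)
  map f := ModuleCat.ofHom (BTensor.map R S C f.hom)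
  map_id _ := ModuleCat.hom_ext (BTensor.hom_ext fun _ _ => rfl)
  map_comp _ _ := ModuleCat.hom_ext (BTensor.hom_ext fun _ _ => rfl)

instance : (tensorFunctor R S C).Additive where
  map_add {_ _ f g} :=
    ModuleCat.hom_ext (BTensor.hom_ext fun c x => btmul_add R S C c (f.hom x) (g.hom x))

/-- `Tor_i^S(C, N)`, the `i`-th left derived functor of `C ⊗_S -` at `N`. -/
noncomputable def TorC (i : ℕ) (N : ModuleCat.{u} S) : ModuleCat.{u} R :=
  ((tensorFunctor R S C).leftDerived i).obj N

end Tensor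

section Hom

variable (R S C : Type u) [Ring R] [Ring S] [AddCommGroup C] [Module R C] [Module Sᵐᵒᵖ C]
  [SMulCommClass R Sᵐᵒᵖ C]

/-- Left multiplication by `r` on `C`, as a homomorphism of right `S`-modules. -/
def leftMul (r : R) : C →ₗ[Sᵐᵒᵖ] C where
  toFun c := r • c
  map_add' c d := smul_add r c d
  map_smul' s c := smul_comm r s c

/-- Right multiplication by `s` on `C`, as a homomorphism of left `R`-modules. -/
def rightMul (s : S) : C →ₗ[R] C where
  toFun c := op s • c
  map_add' c d := smul_add (op s) c d
  map_smul' r c := (smul_comm r (op s) c).symm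

variable (M : Type u) [AddCommGroup M] [Module R M]

/-- The abelian group `Hom_R(C, M)`; as a type depending on `S` it carries the structure of a
left `S`-module defined below. -/
@[nolint unusedArguments]
def HomC (R _S C : Type u) [Ring R] [AddCommGroup C] [Module R C]
    (M : Type u) [AddCommGroup M] [Module R M] : Type u := C →ₗ[R] M

instance : AddCommGroup (HomC R S C M) := inferInstanceAs (AddCommGroup (C →ₗ[R] M))

variable {R S C M}

/-- An element of `Hom_R(C, M)` as a linear map. -/
def HomC.toLin (f : HomC R S C M) : C →ₗ[R] M := f

/-- A linear map as an element of `Hom_R(C, M)`. -/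
def HomC.ofLin (f : C →ₗ[R] M) : HomC R S C M := f

lemma HomC.ext {f g : HomC R S C M} (h : ∀ c, f.toLin c = g.toLin c) : f = g :=
  LinearMap.ext h

/-- `Hom_R(C, M)` is a left `S`-module by `(s * f) c = f (c * s)`. -/
instance : Module S (HomC R S C M) where
  smul s f := HomC.ofLin (f.toLin ∘ₗ rightMul R S C s)
  one_smul f := HomC.ext fun c => congrArg f.toLin (one_smul Sᵐᵒᵖ c)
  mul_smul s t f := HomC.ext fun c => congrArg f.toLin (mul_smul (op t) (op s) c)
  smul_zero _ := rfl
  smul_add _ _ _ := rfl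
  add_smul s t f := HomC.ext fun c =>
    (congrArg f.toLin (add_smul (op s) (op t) c)).trans (map_add f.toLin _ _)
  zero_smul f := HomC.ext fun c =>
    (congrArg f.toLin (zero_smul Sᵐᵒᵖ c)).trans (map_zero f.toLin)

variable (R S C)

/-- The canonical valuation homomorphism `μ_N : N → Hom_R(C, C ⊗_S N)`, `μ_N x c = c ⊗ x`. -/
def muC (N : Type u) [AddCommGroup N] [Module S N] : N →ₗ[S] HomC R S C (BTensor R S C N) where
  toFun x := HomC.ofLin
    { toFun := fun c => btmul R S C c x
      map_add' := fun c d => add_btmul R S C c d x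
      map_smul' := fun r c => smul_btmul R S C r c x }
  map_add' x y := HomC.ext fun c => btmul_add R S C c x y
  map_smul' s x := HomC.ext fun c => (btmul_smul R c s x).symm

end Hom

section Classes

variable (R S C : Type u) [Ring R] [Ring S] [AddCommGroup C] [Module R C] [Module Sᵐᵒᵖ C]
  [SMulCommClass R Sᵐᵒᵖ C]

/-- A module has a degreewise finite projective resolution: a resolution by finitely generated
projective modules. -/
def HasDegreewiseFiniteResolution {A : Type u} [Ring A] (M : ModuleCat.{u} A) : Prop :=
  ∃ P : ProjectiveResolution M, ∀ i : ℕ, Module.Finite A (P.complex.X i)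

/-- The `(R, S)`-bimodule `C` is semidualizing. -/
structure IsSemidualizing : Prop where
  finite_left : HasDegreewiseFiniteResolution (ModuleCat.of R C)
  finite_right : HasDegreewiseFiniteResolution (ModuleCat.of Sᵐᵒᵖ C)
  /-- the homothety map `R → Hom_{Sᵒᵖ}(C, C)`, `r ↦ (c ↦ r * c)`, is an isomorphism -/
  homothety_left : Function.Bijective (leftMul R S C)
  /-- the homothety map `S → Hom_R(C, C)`, `s ↦ (c ↦ c * s)`, is an isomorphism -/
  homothety_right : Function.Bijective (rightMul R S C)
  ext_left : ∀ i : ℕ, 1 ≤ i →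
    Subsingleton (Abelian.Ext.{u} (ModuleCat.of R C) (ModuleCat.of R C) i)
  ext_right : ∀ i : ℕ, 1 ≤ i →
    Subsingleton (Abelian.Ext.{u} (ModuleCat.of Sᵐᵒᵖ C) (ModuleCat.of Sᵐᵒᵖ C) i)

/-- The Auslander class `𝒜_C(S)` in `Mod S`. -/
structure InAuslander (N : ModuleCat.{u} S) : Prop where
  tor_vanish : ∀ i : ℕ, 1 ≤ i → Subsingleton (TorC R S C i N)
  ext_vanish : ∀ i : ℕ, 1 ≤ i →
    Subsingleton (Abelian.Ext.{u} (ModuleCat.of R C) (ModuleCat.of R (BTensor R S C N)) i)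
  mu_bijective : Function.Bijective (muC R S C N)

/-- The class `ℐ_C(S)` of `C`-injective modules: those isomorphic to `Hom_R(C, I)` for some
injective left `R`-module `I`. -/
def IsCInjective (U : ModuleCat.{u} S) : Prop :=
  ∃ I : ModuleCat.{u} R, Injective I ∧ Nonempty (U ≃ₗ[S] HomC R S C I)

end Classes

section Dimension

variable {S : Type u} [Ring S]

/-- `0 → L → M → K → 0` is exact. -/
def IsShortExact {L M K : ModuleCat.{u} S} (f : L →ₗ[S] M) (g : M →ₗ[S] K) : Prop :=
  Function.Injective f ∧ Function.Exact f g ∧ Function.Surjective g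

/-- The sequence `0 → L → M → K → 0` becomes exact after applying `Hom_S(-, X)`
for every `X` in the class `𝒳`: the sequence
`0 → Hom_S(K, X) → Hom_S(M, X) → Hom_S(L, X) → 0` is exact. -/
def IsHomExact (𝒳 : ModuleCat.{u} S → Prop) {L M K : ModuleCat.{u} S}
    (f : L →ₗ[S] M) (g : M →ₗ[S] K) : Prop :=
  ∀ X : ModuleCat.{u} S, 𝒳 X →
    Function.Injective (fun φ : K →ₗ[S] X => φ ∘ₗ g) ∧
    Function.Exact (fun φ : K →ₗ[S] X => φ ∘ₗ g) (fun φ : M →ₗ[S] X => φ ∘ₗ f) ∧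
    Function.Surjective (fun φ : M →ₗ[S] X => φ ∘ₗ f)

/-- There is an exact sequence `0 → X_n → ⋯ → X_1 → X_0 → N → 0` with all `X_i` in `𝒳`
(continued to the left by `X_i = 0` for `i > n`). -/
def HasResolutionOfLength (𝒳 : ModuleCat.{u} S → Prop) (N : ModuleCat.{u} S) (n : ℕ) : Prop :=
  ∃ (X : ℕ → ModuleCat.{u} S) (d : ∀ i, X (i + 1) →ₗ[S] X i) (ε : X 0 →ₗ[S] N),
    (∀ i, i ≤ n → 𝒳 (X i)) ∧ (∀ i, n < i → Subsingleton (X i)) ∧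
    Function.Surjective ε ∧ Function.Exact (d 0) ε ∧
    ∀ i, Function.Exact (d (i + 1)) (d i)

/-- The `𝒳`-projective dimension of `N`: the infimum of all `n` for which there is an exact
sequence `0 → X_n → ⋯ → X_0 → N → 0` with all `X_i` in `𝒳`, and `⊤` if there is none. -/
noncomputable def relPd (𝒳 : ModuleCat.{u} S → Prop) (N : ModuleCat.{u} S) : ℕ∞ :=
  ⨅ (n : ℕ) (_ : HasResolutionOfLength 𝒳 N n), (n : ℕ∞)

/-- `K` is an `n`-th syzygy `Ω^n(N)` of `N`: `Ω^0(N) = N`, and `Ω^(n+1)(N)` is an `n`-th syzygy of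
the kernel of a surjection from a projective module onto `N`. Syzygies depend on the choice of
these surjections, so this is a relation. -/
def IsSyzygy : ℕ → ModuleCat.{u} S → ModuleCat.{u} S → Prop
  | 0, N, K => Nonempty (K ≃ₗ[S] N)
  | n + 1, N, K => ∃ (P : ModuleCat.{u} S) (p : P →ₗ[S] N), Module.Projective S P ∧
      Function.Surjective p ∧ IsSyzygy n (ModuleCat.of S (LinearMap.ker p)) K

end Dimension

end AuslanderClass

open AuslanderClass

/-! Write C⁺ = Hom_ℤ(C, ℚ/ℤ). By adjunction the characters of C ⊗_S N are the maps N → C⁺, so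
Tor_i(C, N) = 0 exactly when Ext_S^i(N, C⁺) = 0 (`subsingleton_torC_iff`). All Tor arguments thereby
become dimension shifts in long exact Ext sequences.

The Auslander class contains the projectives (`inAuslander_of_projective`) and the C-injectives
(`IsCInjective.inAuslander`). It is closed under extensions, under kernels of epimorphisms, and
under those cokernels of monomorphisms whose Tor_1 vanishes. Working inwards from the end of a
finite resolution, the last property puts every module of finite Auslander dimension with vanishing
Tor into the class (`ResDim.inAuslander`). Finite dimension passes to syzygies
(`exists_resDim_ker`), and the Tor of a syzygy is a shifted Tor of N; this links dimension, syzygies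
and Tor.

The two short exact sequences are Auslander–Buchweitz approximations. A module in the class embeds
into a C-injective one with cokernel in the class (`InAuslander.exists_embedding`). Induction on the
dimension, with a pushout in each step, turns this into hulls and covers (`ResDim.exists_hull`,
`ResDim.exists_cover`). Conversely such sequences bound the dimension or the Tor of N. Hom-exactness
is automatic, since Ext^1(A', U) = 0 for A' in the class and U C-injective. -/

namespace AuslanderClass

/-! ### Long exact Ext sequences as vanishing and lifting criteria -/

section Ext

variable {A : Type u} [Ring A] {L M K X Y : ModuleCat.{u} A}

/-- A short exact sequence of modules as a short complex. -/
lemma IsShortExact.shortExact {f : L →ₗ[A] M} {g : M →ₗ[A] K} (h : IsShortExact f g) :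
    (ShortComplex.mk (ModuleCat.ofHom f) (ModuleCat.ofHom g)
      (ModuleCat.hom_ext h.2.1.linearMap_comp_eq_zero)).ShortExact where
  exact := by
    rw [ShortComplex.ShortExact.moduleCat_exact_iff_function_exact]
    exact h.2.1
  mono_f := (ModuleCat.mono_iff_injective _).2 h.1
  epi_g := (ModuleCat.epi_iff_surjective _).2 h.2.2

lemma isShortExact_ker {P : ModuleCat.{u} A} (p : P →ₗ[A] X) (hp : Function.Surjective p) :
    IsShortExact (L := ModuleCat.of A (LinearMap.ker p)) (LinearMap.ker p).subtype p :=
  ⟨Subtype.val_injective, LinearMap.exact_subtype_ker_map p, hp⟩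

lemma isShortExact_mkQ (f : L →ₗ[A] M) (hf : Function.Injective f) :
    IsShortExact (K := ModuleCat.of A (M ⧸ LinearMap.range f)) f (LinearMap.range f).mkQ :=
  ⟨hf, LinearMap.exact_map_mkQ_range f, Submodule.mkQ_surjective _⟩

/-- `Ext^i(X, Y) = 0`. -/
abbrev ExtZero (X Y : ModuleCat.{u} A) (i : ℕ) : Prop := Subsingleton (Abelian.Ext.{u} X Y i)

lemma extZero_of_retract_left (s : X →ₗ[A] Y) (r : Y →ₗ[A] X) (h : r ∘ₗ s = LinearMap.id)
    {Z : ModuleCat.{u} A} {i : ℕ} (hY : ExtZero Y Z i) : ExtZero X Z i := by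
  refine subsingleton_of_forall_eq 0 fun x => ?_
  have h1 : ModuleCat.ofHom s ≫ ModuleCat.ofHom r = 𝟙 X := ModuleCat.hom_ext h
  have h2 : (Abelian.Ext.mk₀ (ModuleCat.ofHom r)).comp x (zero_add i) = 0 := Subsingleton.elim _ _
  have h3 := congrArg
    (fun y => (Abelian.Ext.mk₀ (ModuleCat.ofHom s)).comp y (zero_add i)) h2
  simpa [← Abelian.Ext.comp_assoc_of_second_deg_zero, h1] using h3

lemma extZero_of_retract_right (s : X →ₗ[A] Y) (r : Y →ₗ[A] X) (h : r ∘ₗ s = LinearMap.id)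
    {Z : ModuleCat.{u} A} {i : ℕ} (hY : ExtZero Z Y i) : ExtZero Z X i := by
  refine subsingleton_of_forall_eq 0 fun x => ?_
  have h1 : ModuleCat.ofHom s ≫ ModuleCat.ofHom r = 𝟙 X := ModuleCat.hom_ext h
  have h2 : x.comp (Abelian.Ext.mk₀ (ModuleCat.ofHom s)) (add_zero i) = 0 := Subsingleton.elim _ _
  have h3 := congrArg
    (fun y => y.comp (Abelian.Ext.mk₀ (ModuleCat.ofHom r)) (add_zero i)) h2
  simpa [h1] using h3

lemma extZero_congr_right (e : X ≃ₗ[A] Y) {Z : ModuleCat.{u} A} {i : ℕ} (hY : ExtZero Z Y i) :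
    ExtZero Z X i :=
  extZero_of_retract_right e.toLinearMap e.symm.toLinearMap (by ext; simp) hY

lemma extZero_of_projective [Module.Projective A X] {i : ℕ} (hi : 1 ≤ i) : ExtZero X Y i := by
  obtain ⟨i, rfl⟩ := Nat.exists_eq_add_of_le' hi
  have : Projective X := (IsProjective.iff_projective (R := A) X).1 inferInstance
  exact Abelian.Ext.subsingleton_of_projective X Y i

lemma extZero_of_injective [Injective Y] {i : ℕ} (hi : 1 ≤ i) : ExtZero X Y i := by
  obtain ⟨i, rfl⟩ := Nat.exists_eq_add_of_le' hi
  exact Abelian.Ext.subsingleton_of_injective X Y i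

variable {f : L →ₗ[A] M} {g : M →ₗ[A] K}

namespace IsShortExact

lemma extZero_left₂ (h : IsShortExact f g) {i : ℕ} (h₁ : ExtZero L Y i) (h₃ : ExtZero K Y i) :
    ExtZero M Y i := by
  refine subsingleton_of_forall_eq 0 fun x => ?_
  obtain ⟨y, rfl⟩ := Abelian.Ext.contravariant_sequence_exact₂ h.shortExact Y x
    (Subsingleton.elim (h := h₁) _ _)
  rw [Subsingleton.elim (h := h₃) y 0, Abelian.Ext.comp_zero]

lemma extZero_left₁ (h : IsShortExact f g) {i : ℕ} (h₂ : ExtZero M Y i)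
    (h₃ : ExtZero K Y (i + 1)) : ExtZero L Y i := by
  refine subsingleton_of_forall_eq 0 fun x => ?_
  obtain ⟨y, rfl⟩ := Abelian.Ext.contravariant_sequence_exact₁ h.shortExact Y x (add_comm 1 i)
    (Subsingleton.elim (h := h₃) _ _)
  rw [Subsingleton.elim (h := h₂) y 0, Abelian.Ext.comp_zero]

lemma extZero_left₃ (h : IsShortExact f g) {i : ℕ} (h₁ : ExtZero L Y i)
    (h₂ : ExtZero M Y (i + 1)) : ExtZero K Y (i + 1) := by
  refine subsingleton_of_forall_eq 0 fun x => ?_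
  obtain ⟨y, rfl⟩ := Abelian.Ext.contravariant_sequence_exact₃ h.shortExact Y x
    (Subsingleton.elim (h := h₂) _ _) (add_comm 1 i)
  rw [Subsingleton.elim (h := h₁) y 0, Abelian.Ext.comp_zero]

lemma extZero_right₂ (h : IsShortExact f g) {i : ℕ} (h₁ : ExtZero X L i) (h₃ : ExtZero X K i) :
    ExtZero X M i := by
  refine subsingleton_of_forall_eq 0 fun x => ?_
  obtain ⟨y, rfl⟩ := Abelian.Ext.covariant_sequence_exact₂ X h.shortExact x
    (Subsingleton.elim (h := h₃) _ _)
  rw [Subsingleton.elim (h := h₁) y 0, Abelian.Ext.zero_comp]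

lemma extZero_right₁ (h : IsShortExact f g) {i : ℕ} (h₂ : ExtZero X M (i + 1))
    (h₃ : ExtZero X K i) : ExtZero X L (i + 1) := by
  refine subsingleton_of_forall_eq 0 fun x => ?_
  obtain ⟨y, rfl⟩ := Abelian.Ext.covariant_sequence_exact₁ X h.shortExact x
    (Subsingleton.elim (h := h₂) _ _) rfl
  rw [Subsingleton.elim (h := h₃) y 0, Abelian.Ext.zero_comp]

lemma extZero_right₃ (h : IsShortExact f g) {i : ℕ} (h₁ : ExtZero X L (i + 1))
    (h₂ : ExtZero X M i) : ExtZero X K i := by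
  refine subsingleton_of_forall_eq 0 fun x => ?_
  obtain ⟨y, rfl⟩ := Abelian.Ext.covariant_sequence_exact₃ X h.shortExact x rfl
    (Subsingleton.elim (h := h₁) _ _)
  rw [Subsingleton.elim (h := h₂) y 0, Abelian.Ext.zero_comp]

lemma exists_extend (h : IsShortExact f g) (h₃ : ExtZero K Y 1) (φ : L →ₗ[A] Y) :
    ∃ ψ : M →ₗ[A] Y, ψ ∘ₗ f = φ := by
  obtain ⟨y, hy⟩ := Abelian.Ext.contravariant_sequence_exact₁ h.shortExact Y
    (Abelian.Ext.mk₀ (ModuleCat.ofHom φ)) (add_zero 1) (Subsingleton.elim (h := h₃) _ _)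
  obtain ⟨ψ, rfl⟩ := (Abelian.Ext.mk₀_bijective _ _).2 y
  rw [Abelian.Ext.mk₀_comp_mk₀] at hy
  exact ⟨ψ.hom, congrArg ModuleCat.Hom.hom ((Abelian.Ext.mk₀_bijective _ _).1 hy)⟩

/-- When Ext^1(M, Y) = 0, the group Ext^1(K, Y) is the cokernel of restriction Hom(M, Y) → Hom(L,
Y). -/
lemma extZero_one_left (h : IsShortExact f g) (h₂ : ExtZero M Y 1)
    (H : ∀ φ : L →ₗ[A] Y, ∃ ψ : M →ₗ[A] Y, ψ ∘ₗ f = φ) : ExtZero K Y 1 := by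
  refine subsingleton_of_forall_eq 0 fun x => ?_
  obtain ⟨y, rfl⟩ := Abelian.Ext.contravariant_sequence_exact₃ h.shortExact Y x
    (Subsingleton.elim (h := h₂) _ _) (add_zero 1)
  obtain ⟨φ, rfl⟩ := (Abelian.Ext.mk₀_bijective _ _).2 y
  obtain ⟨ψ, hψ⟩ := H φ.hom
  obtain rfl : ModuleCat.ofHom f ≫ ModuleCat.ofHom ψ = φ := ModuleCat.hom_ext hψ
  rw [← Abelian.Ext.mk₀_comp_mk₀]
  exact h.shortExact.extClass_comp_assoc _

lemma exists_lift (h : IsShortExact f g) (h₁ : ExtZero X L 1) (φ : X →ₗ[A] K) :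
    ∃ ψ : X →ₗ[A] M, g ∘ₗ ψ = φ := by
  obtain ⟨y, hy⟩ := Abelian.Ext.covariant_sequence_exact₃ X h.shortExact
    (Abelian.Ext.mk₀ (ModuleCat.ofHom φ)) (zero_add 1) (Subsingleton.elim (h := h₁) _ _)
  obtain ⟨ψ, rfl⟩ := (Abelian.Ext.mk₀_bijective _ _).2 y
  rw [Abelian.Ext.mk₀_comp_mk₀] at hy
  exact ⟨ψ.hom, congrArg ModuleCat.Hom.hom ((Abelian.Ext.mk₀_bijective _ _).1 hy)⟩

lemma extZero_one_right (h : IsShortExact f g) (h₂ : ExtZero X M 1)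
    (H : ∀ φ : X →ₗ[A] K, ∃ ψ : X →ₗ[A] M, g ∘ₗ ψ = φ) : ExtZero X L 1 := by
  refine subsingleton_of_forall_eq 0 fun x => ?_
  obtain ⟨y, rfl⟩ := Abelian.Ext.covariant_sequence_exact₁ X h.shortExact x
    (Subsingleton.elim (h := h₂) _ _) (zero_add 1)
  obtain ⟨φ, rfl⟩ := (Abelian.Ext.mk₀_bijective _ _).2 y
  obtain ⟨ψ, hψ⟩ := H φ.hom
  obtain rfl : ModuleCat.ofHom ψ ≫ ModuleCat.ofHom g = φ := ModuleCat.hom_ext hψ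
  rw [← Abelian.Ext.mk₀_comp_mk₀, Abelian.Ext.comp_assoc_of_second_deg_zero,
    h.shortExact.comp_extClass, Abelian.Ext.comp_zero]

end IsShortExact

end Ext

/-! ### Factoring maps through surjections and into injectives -/

section Factor

variable {A : Type*} [Ring A] {X Y Z : Type*} [AddCommGroup X] [Module A X] [AddCommGroup Y]
  [Module A Y] [AddCommGroup Z] [Module A Z]

lemma exists_factor_of_surjective (g : X →ₗ[A] Y) (hg : Function.Surjective g) (t : X →ₗ[A] Z)
    (h : LinearMap.ker g ≤ LinearMap.ker t) : ∃ t' : Y →ₗ[A] Z, t' ∘ₗ g = t := by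
  refine ⟨(LinearMap.ker g).liftQ t h ∘ₗ (g.quotKerEquivOfSurjective hg).symm.toLinearMap, ?_⟩
  ext m
  have : (g.quotKerEquivOfSurjective hg).symm (g m) = (LinearMap.ker g).mkQ m :=
    (LinearEquiv.symm_apply_eq _).2 rfl
  change (LinearMap.ker g).liftQ t h ((g.quotKerEquivOfSurjective hg).symm (g m)) = _
  rw [this]
  rfl

end Factor

section Injective

variable {A : Type u} [Ring A]

/-- A homomorphism to an injective module extends along injective maps. -/
lemma exists_extend_of_injective {I : ModuleCat.{u} A} [hI : Injective I]
    {X Y : Type u} [AddCommGroup X] [Module A X] [AddCommGroup Y] [Module A Y]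
    (f : X →ₗ[A] Y) (hf : Function.Injective f) (t : X →ₗ[A] I) :
    ∃ t' : Y →ₗ[A] I, t' ∘ₗ f = t := by
  have : Mono (ModuleCat.ofHom f) := (ModuleCat.mono_iff_injective _).2 hf
  exact ⟨(Injective.factorThru (ModuleCat.ofHom t) (ModuleCat.ofHom f)).hom,
    congrArg ModuleCat.Hom.hom (Injective.comp_factorThru (ModuleCat.ofHom t) (ModuleCat.ofHom f))⟩

/-- A homomorphism to an injective module that vanishes on the kernel of `g` factors through
`g`. -/
lemma exists_factor_of_injective {I : ModuleCat.{u} A} [hI : Injective I]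
    {X Y : Type u} [AddCommGroup X] [Module A X] [AddCommGroup Y] [Module A Y]
    (g : X →ₗ[A] Y) (t : X →ₗ[A] I) (h : LinearMap.ker g ≤ LinearMap.ker t) :
    ∃ t' : Y →ₗ[A] I, t' ∘ₗ g = t := by
  -- X / ker g embeds into Y, so the induced map on the quotient extends to Y.
  obtain ⟨t', ht'⟩ := exists_extend_of_injective ((LinearMap.ker g).liftQ g le_rfl)
    (LinearMap.ker_eq_bot.1 (Submodule.ker_liftQ_eq_bot _ _ _ le_rfl))
    ((LinearMap.ker g).liftQ t h)
  exact ⟨t', LinearMap.ext fun x => LinearMap.congr_fun ht' ((LinearMap.ker g).mkQ x)⟩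

end Injective

/-! ### Characters with values in ℚ/ℤ -/

section Character

variable {X Y Z : Type*} [AddCommGroup X] [AddCommGroup Y] [AddCommGroup Z]

lemma exists_character_extend (f : X →+ Y) (hf : Function.Injective f)
    (χ : X →+ AddCircle (1 : ℚ)) : ∃ χ' : Y →+ AddCircle (1 : ℚ), χ'.comp f = χ := by
  obtain ⟨χ', h⟩ := CharacterModule.dual_surjective_of_injective f.toIntLinearMap hf χ
  exact ⟨χ', h⟩

lemma exists_character_factor (g : X →+ Y) (χ : X →+ AddCircle (1 : ℚ)) (h : g.ker ≤ χ.ker) :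
    ∃ χ' : Y →+ AddCircle (1 : ℚ), χ'.comp g = χ := by
  obtain ⟨χ', hχ⟩ := exists_character_extend (QuotientAddGroup.kerLift g)
    (QuotientAddGroup.kerLift_injective g) (QuotientAddGroup.lift g.ker χ h)
  exact ⟨χ', AddMonoidHom.ext fun x => DFunLike.congr_fun hχ (QuotientAddGroup.mk x)⟩

/-- Exactness is detected by characters. -/
lemma exact_of_character (f : X →+ Y) (g : Y →+ Z) (hgf : ∀ x, g (f x) = 0)
    (H : ∀ χ : Y →+ AddCircle (1 : ℚ), χ.comp f = 0 →
      ∃ χ' : Z →+ AddCircle (1 : ℚ), χ'.comp g = χ) : Function.Exact f g := by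
  refine fun y => ⟨fun hy => ?_, ?_⟩
  -- Characters separate the points of Y / im f. Each one pulls back to a character of Y killed by
  -- f, hence of the form χ' ∘ g, and so vanishes at y.
  · have h0 : QuotientAddGroup.mk' f.range y = 0 := by
      refine CharacterModule.eq_zero_of_character_apply fun c => ?_
      obtain ⟨χ', hχ⟩ := H (AddMonoidHom.comp (c : _ →+ AddCircle (1 : ℚ))
        (QuotientAddGroup.mk' f.range)) (by
          ext x
          change c (QuotientAddGroup.mk' f.range (f x)) = 0
          have : QuotientAddGroup.mk' f.range (f x) = 0 :=
            (QuotientAddGroup.eq_zero_iff (N := f.range) (f x)).2 ⟨x, rfl⟩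
          rw [this]
          exact map_zero c)
      have := DFunLike.congr_fun hχ y
      change χ' (g y) = c _ at this
      rw [← this, hy, map_zero]
    exact (QuotientAddGroup.eq_zero_iff y).1 h0
  · rintro ⟨x, rfl⟩
    exact hgf x

lemma injective_of_character (f : X →+ Y)
    (H : ∀ χ : X →+ AddCircle (1 : ℚ), ∃ χ' : Y →+ AddCircle (1 : ℚ), χ'.comp f = χ) :
    Function.Injective f := by
  refine (injective_iff_map_eq_zero f).2 fun x hx => ?_
  refine CharacterModule.eq_zero_of_character_apply fun c => ?_
  obtain ⟨χ', hχ⟩ := H c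
  have := DFunLike.congr_fun hχ x
  change χ' (f x) = c x at this
  rw [← this, hx, map_zero]

lemma surjective_of_character (f : X →+ Y)
    (H : ∀ χ : Y →+ AddCircle (1 : ℚ), χ.comp f = 0 → χ = 0) :
    Function.Surjective f := by
  have := exact_of_character f (0 : Y →+ Y) (fun _ => rfl) fun χ hχ => ⟨0, by rw [H χ hχ]; rfl⟩
  exact fun y => (this y).1 rfl

end Character

/-! ### Character modules and their injectivity -/

section CharacterDual

/-- The character module `Hom_ℤ(D, ℚ/ℤ)` of a right `S`-module, as a left `S`-module. -/
@[nolint unusedArguments]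
def CharDual (_S D : Type u) [AddCommGroup D] : Type u := D →+ AddCircle (1 : ℚ)

variable (S D : Type u) [AddCommGroup D]

instance : AddCommGroup (CharDual S D) := inferInstanceAs (AddCommGroup (D →+ AddCircle (1 : ℚ)))

variable {S D}

/-- An element of the character module as an additive map. -/
def CharDual.toHom (χ : CharDual S D) : D →+ AddCircle (1 : ℚ) := χ

/-- An additive map as an element of the character module. -/
def CharDual.ofHom (χ : D →+ AddCircle (1 : ℚ)) : CharDual S D := χ

lemma CharDual.ext {χ ψ : CharDual S D} (h : ∀ d, χ.toHom d = ψ.toHom d) : χ = ψ :=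
  DFunLike.ext (F := D →+ AddCircle (1 : ℚ)) χ ψ h

variable [Ring S] [Module Sᵐᵒᵖ D]

instance : Module S (CharDual S D) where
  smul s χ := CharDual.ofHom (χ.toHom.comp (DistribSMul.toAddMonoidHom D (op s)))
  one_smul χ := CharDual.ext fun d => congrArg χ.toHom (one_smul Sᵐᵒᵖ d)
  mul_smul s t χ := CharDual.ext fun d => congrArg χ.toHom (mul_smul (op t) (op s) d)
  smul_zero _ := rfl
  smul_add _ _ _ := rfl
  add_smul s t χ := CharDual.ext fun d =>
    (congrArg χ.toHom (add_smul (op s) (op t) d)).trans (map_add χ.toHom _ _)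
  zero_smul χ := CharDual.ext fun d =>
    (congrArg χ.toHom (zero_smul Sᵐᵒᵖ d)).trans (map_zero χ.toHom)

/-- The homomorphism of character modules induced by a homomorphism of right modules. -/
def CharDual.map {D' : Type u} [AddCommGroup D'] [Module Sᵐᵒᵖ D'] (a : D →ₗ[Sᵐᵒᵖ] D') :
    CharDual S D' →ₗ[S] CharDual S D where
  toFun χ := CharDual.ofHom (χ.toHom.comp a.toAddMonoidHom)
  map_add' _ _ := rfl
  map_smul' s χ := CharDual.ext fun d => congrArg χ.toHom (a.map_smul (op s) d).symm

lemma CharDual.isShortExact {L M K : ModuleCat.{u} Sᵐᵒᵖ} {f : L →ₗ[Sᵐᵒᵖ] M} {g : M →ₗ[Sᵐᵒᵖ] K}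
    (h : IsShortExact f g) :
    IsShortExact (L := ModuleCat.of S (CharDual S K)) (M := ModuleCat.of S (CharDual S M))
      (K := ModuleCat.of S (CharDual S L)) (CharDual.map g) (CharDual.map f) := by
  refine ⟨fun χ ψ hχ => CharDual.ext (S := S) fun k => ?_, fun χ => ⟨fun hχ => ?_, ?_⟩, fun χ => ?_⟩
  · obtain ⟨m, rfl⟩ := h.2.2 k
    exact DFunLike.congr_fun (F := M →+ AddCircle (1 : ℚ)) hχ m
  · obtain ⟨χ', hχ'⟩ := exists_character_factor g.toAddMonoidHom (CharDual.toHom (S := S) χ) (by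
      intro m hm
      obtain ⟨l, rfl⟩ := (h.2.1 m).1 hm
      exact DFunLike.congr_fun (F := L →+ AddCircle (1 : ℚ)) hχ l)
    exact ⟨CharDual.ofHom (S := S) χ', hχ'⟩
  · rintro ⟨χ, rfl⟩
    refine CharDual.ext (S := S) fun l => ?_
    change χ.toHom (g (f l)) = 0
    rw [h.2.1.apply_apply_eq_zero, map_zero]
  · obtain ⟨χ', hχ'⟩ := exists_character_extend f.toAddMonoidHom h.1 (CharDual.toHom (S := S) χ)
    exact ⟨CharDual.ofHom (S := S) χ', hχ'⟩

/-- The character module of a left `S`-module, as a right `S`-module. -/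
@[nolint unusedArguments]
def CharDualOp (_S N : Type u) [AddCommGroup N] : Type u := N →+ AddCircle (1 : ℚ)

instance {N : Type u} [AddCommGroup N] : AddCommGroup (CharDualOp S N) :=
  inferInstanceAs (AddCommGroup (N →+ AddCircle (1 : ℚ)))

instance {N : Type u} [AddCommGroup N] [Module S N] : Module Sᵐᵒᵖ (CharDualOp S N) where
  smul s χ := AddMonoidHom.comp (show N →+ AddCircle (1 : ℚ) from χ)
    (DistribSMul.toAddMonoidHom N (unop s))
  one_smul χ := DFunLike.ext (F := N →+ AddCircle (1 : ℚ)) _ _ fun x =>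
    DFunLike.congr_arg (F := N →+ AddCircle (1 : ℚ)) χ (one_smul S x)
  mul_smul s t χ := DFunLike.ext (F := N →+ AddCircle (1 : ℚ)) _ _ fun x =>
    DFunLike.congr_arg (F := N →+ AddCircle (1 : ℚ)) χ (mul_smul (unop t) (unop s) x)
  smul_zero _ := rfl
  smul_add _ _ _ := rfl
  add_smul s t χ := DFunLike.ext (F := N →+ AddCircle (1 : ℚ)) _ _ fun x =>
    (DFunLike.congr_arg (F := N →+ AddCircle (1 : ℚ)) χ (add_smul (unop s) (unop t) x)).trans
      (AddMonoidHom.map_add χ _ _)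
  zero_smul χ := DFunLike.ext (F := N →+ AddCircle (1 : ℚ)) _ _ fun x =>
    (DFunLike.congr_arg (F := N →+ AddCircle (1 : ℚ)) χ (zero_smul S x)).trans
      (AddMonoidHom.map_zero χ)

/-- The character module of a projective right module is an injective left module. -/
lemma CharDual.injective [Module.Projective Sᵐᵒᵖ D] :
    Injective (ModuleCat.of S (CharDual S D)) where
  factors {X Y} g f hf := by
    have hf' := (ModuleCat.mono_iff_injective _).1 hf
    -- Swapping the two arguments turns the extension problem X → D⁺ along f into a lifting problem
    -- D → X⁺ along Y⁺ → X⁺. The latter map is surjective, so projectivity of D solves it.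
    let res : CharDualOp S Y →ₗ[Sᵐᵒᵖ] CharDualOp S X :=
      { toFun := fun χ => AddMonoidHom.comp (show Y →+ AddCircle (1 : ℚ) from χ)
          f.hom.toAddMonoidHom
        map_add' := fun _ _ => rfl
        map_smul' := fun s χ => DFunLike.ext (F := X →+ AddCircle (1 : ℚ)) _ _ fun x =>
          DFunLike.congr_arg (F := Y →+ AddCircle (1 : ℚ)) χ (f.hom.map_smul (unop s) x).symm }
    let g' : D →ₗ[Sᵐᵒᵖ] CharDualOp S X :=
      { toFun := fun d => (AddMonoidHom.mk' (fun x => CharDual.toHom (g.hom x) d)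
          fun x y => congrArg (fun c => CharDual.toHom c d) (map_add g.hom x y) :
            X →+ AddCircle (1 : ℚ))
        map_add' := fun d e => DFunLike.ext (F := X →+ AddCircle (1 : ℚ)) _ _ fun x =>
          map_add (CharDual.toHom (g.hom x)) d e
        map_smul' := fun s d => DFunLike.ext (F := X →+ AddCircle (1 : ℚ)) _ _ fun x =>
          congrArg (fun c => CharDual.toHom c d) (g.hom.map_smul (unop s) x).symm }
    obtain ⟨h', hh'⟩ := Module.projective_lifting_property res g' fun χ =>
      exists_character_extend f.hom.toAddMonoidHom hf' χ
    have key : ∀ d x, (show Y →+ AddCircle (1 : ℚ) from h' d) (f.hom x) =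
        CharDual.toHom (g.hom x) d := fun d x =>
      DFunLike.congr_fun (F := X →+ AddCircle (1 : ℚ)) (LinearMap.congr_fun hh' d) x
    refine ⟨ModuleCat.ofHom
      { toFun := fun y => CharDual.ofHom (AddMonoidHom.mk'
          (fun d => (show Y →+ AddCircle (1 : ℚ) from h' d) y)
          fun d e => DFunLike.congr_fun (F := Y →+ AddCircle (1 : ℚ)) (map_add h' d e) y)
        map_add' := fun y z => CharDual.ext fun d =>
          map_add (show Y →+ AddCircle (1 : ℚ) from h' d) y z
        map_smul' := fun s y => CharDual.ext fun d =>
          (DFunLike.congr_fun (F := Y →+ AddCircle (1 : ℚ)) (h'.map_smul (op s) d) y).symm }, ?_⟩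
    exact ModuleCat.hom_ext (LinearMap.ext fun x => CharDual.ext fun d => key d x)

end CharacterDual

/-! ### Tensor-Hom adjunctions and right exactness of C ⊗_S - -/

section Adjunction

variable {R S C : Type u} [Ring R] [Ring S] [AddCommGroup C] [Module R C] [Module Sᵐᵒᵖ C]
  [SMulCommClass R Sᵐᵒᵖ C]
variable {N N' : Type u} [AddCommGroup N] [Module S N] [AddCommGroup N'] [Module S N']

lemma BTensor.induction {p : BTensor R S C N → Prop} (h0 : p 0)
    (ht : ∀ c x, p (btmul R S C c x)) (ha : ∀ a b, p a → p b → p (a + b))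
    (z : BTensor R S C N) : p z := by
  obtain ⟨z, rfl⟩ := Submodule.mkQ_surjective (balancedSubmodule R S C N) z
  induction z using TensorProduct.induction_on with
  | zero => rw [map_zero]; exact h0
  | tmul c x => exact ht c x
  | add a b h1 h2 => rw [map_add]; exact ha _ _ h1 h2

lemma BTensor.addHom_ext {Z : Type*} [AddCommGroup Z] {f g : BTensor R S C N →+ Z}
    (h : ∀ c x, f (btmul R S C c x) = g (btmul R S C c x)) : f = g := by
  ext z
  induction z using BTensor.induction with
  | h0 => rw [map_zero, map_zero]
  | ht c x => exact h c x
  | ha a b h1 h2 => rw [map_add, map_add, h1, h2]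

/-- A balanced biadditive map factors through the tensor product. -/
def BTensor.liftAdd {Z : Type*} [AddCommGroup Z] (β : C →+ N →+ Z)
    (h : ∀ c (s : S) x, β (op s • c) x = β c (s • x)) : BTensor R S C N →+ Z :=
  QuotientAddGroup.lift (balancedSubmodule R S C N).toAddSubgroup
    (TensorProduct.liftAddHom β fun r c x => by simp) (by
      intro z hz
      change z ∈ AddSubgroup.closure (balancedRel S C N) at hz
      rw [AddMonoidHom.mem_ker]
      induction hz using AddSubgroup.closure_induction with
      | mem z hz =>
        obtain ⟨c, s, x, rfl⟩ := hz
        rw [map_sub, TensorProduct.liftAddHom_tmul, TensorProduct.liftAddHom_tmul, h, sub_self]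
      | zero => rw [map_zero]
      | add a b _ _ ha hb => rw [map_add, ha, hb, add_zero]
      | neg a _ ha => rw [map_neg, ha, neg_zero])

/-- The adjunction isomorphism `Hom_ℤ(C ⊗_S N, ℚ/ℤ) ≅ Hom_S(N, Hom_ℤ(C, ℚ/ℤ))`. -/
def charAdj (χ : BTensor R S C N →+ AddCircle (1 : ℚ)) : N →ₗ[S] CharDual S C where
  toFun x := CharDual.ofHom (AddMonoidHom.mk' (fun c => χ (btmul R S C c x)) fun c d => by
    rw [add_btmul, map_add])
  map_add' x y := CharDual.ext fun c => (congrArg χ (btmul_add R S C c x y)).trans (map_add χ _ _)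
  map_smul' s x := CharDual.ext fun c => congrArg χ (btmul_smul R c s x).symm

lemma charAdj_injective :
    Function.Injective (charAdj : (BTensor R S C N →+ AddCircle (1 : ℚ)) → _) := fun _ _ h =>
  BTensor.addHom_ext fun c x => congrArg (fun l : N →ₗ[S] CharDual S C => CharDual.toHom (l x) c) h

lemma charAdj_surjective :
    Function.Surjective (charAdj : (BTensor R S C N →+ AddCircle (1 : ℚ)) → _) := fun φ =>
  ⟨BTensor.liftAdd (AddMonoidHom.mk' (fun c => AddMonoidHom.mk' (fun x => (φ x).toHom c)
      fun x y => by rw [map_add]; rfl) fun c d => by ext x; exact map_add (φ x).toHom c d)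
      fun c s x => by
        change (φ x).toHom (op s • c) = (φ (s • x)).toHom c
        rw [φ.map_smul]; rfl, rfl⟩

lemma charAdj_comp (χ : BTensor R S C N' →+ AddCircle (1 : ℚ)) (f : N →ₗ[S] N') :
    charAdj (χ.comp (BTensor.map R S C f).toAddMonoidHom) = charAdj χ ∘ₗ f := rfl

lemma charAdj_zero : charAdj (0 : BTensor R S C N →+ AddCircle (1 : ℚ)) = 0 := rfl

variable {J : Type u} [AddCommGroup J] [Module R J]

/-- The adjunction map `Hom_R(C ⊗_S N, J) → Hom_S(N, Hom_R(C, J))`. -/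
def homAdj (t : BTensor R S C N →ₗ[R] J) : N →ₗ[S] HomC R S C J where
  toFun x := HomC.ofLin (t ∘ₗ (muC R S C N x).toLin)
  map_add' x y := HomC.ext fun c => (congrArg t (btmul_add R S C c x y)).trans (map_add t _ _)
  map_smul' s x := HomC.ext fun c => congrArg t (btmul_smul R c s x).symm

/-- The inverse of the adjunction map. -/
def homAdjSymm (φ : N →ₗ[S] HomC R S C J) : BTensor R S C N →ₗ[R] J :=
  let t : BTensor R S C N →+ J := BTensor.liftAdd
    (AddMonoidHom.mk' (fun c => AddMonoidHom.mk' (fun x => (φ x).toLin c)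
      fun x y => by rw [map_add]; rfl) fun c d => by ext x; exact map_add (φ x).toLin c d)
      fun c s x => by
        change (φ x).toLin (op s • c) = (φ (s • x)).toLin c
        rw [φ.map_smul]; rfl
  { t with
    map_smul' := fun r z => by
      change t (r • z) = r • t z
      induction z using BTensor.induction with
      | h0 => rw [smul_zero, map_zero, smul_zero]
      | ht c x =>
        rw [← smul_btmul]
        exact (φ x).toLin.map_smul r c
      | ha a b h1 h2 => rw [smul_add, map_add, h1, h2, map_add, smul_add] }

/-- Composition with an `R`-linear map, as an `S`-linear map on `Hom_R(C, -)`. -/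
def HomC.map {J' : Type u} [AddCommGroup J'] [Module R J'] (a : J →ₗ[R] J') :
    HomC R S C J →ₗ[S] HomC R S C J' where
  toFun f := HomC.ofLin (a ∘ₗ f.toLin)
  map_add' f g := HomC.ext fun c => map_add a (f.toLin c) (g.toLin c)
  map_smul' _ _ := rfl

lemma muC_naturality (f : N →ₗ[S] N') (x : N) :
    HomC.map (BTensor.map R S C f) (muC R S C N x) = muC R S C N' (f x) := rfl

lemma BTensor.map_comp {N'' : Type u} [AddCommGroup N''] [Module S N''] (f : N →ₗ[S] N')
    (g : N' →ₗ[S] N'') : BTensor.map R S C (g ∘ₗ f) = BTensor.map R S C g ∘ₗ BTensor.map R S C f :=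
  BTensor.hom_ext fun _ _ => rfl

lemma BTensor.map_id : BTensor.map R S C (LinearMap.id : N →ₗ[S] N) = LinearMap.id :=
  BTensor.hom_ext fun _ _ => rfl

lemma BTensor.map_zero : BTensor.map R S C (0 : N →ₗ[S] N') = 0 :=
  BTensor.hom_ext fun c x => by
    rw [BTensor.map_btmul, LinearMap.zero_apply, LinearMap.zero_apply]
    simpa using btmul_add R S C c (0 : N') 0

/-- Under `charAdj` the hypothesis says that every character of C ⊗_S N extends along C ⊗ f, and
characters separate points. -/
lemma BTensor.map_injective_of_extend (f : N →ₗ[S] N')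
    (H : ∀ φ : N →ₗ[S] CharDual S C, ∃ ψ : N' →ₗ[S] CharDual S C, ψ ∘ₗ f = φ) :
    Function.Injective (BTensor.map R S C f) := by
  refine injective_of_character (BTensor.map R S C f).toAddMonoidHom fun χ => ?_
  obtain ⟨ψ, hψ⟩ := H (charAdj χ)
  obtain ⟨χ', rfl⟩ := charAdj_surjective (R := R) ψ
  exact ⟨χ', charAdj_injective hψ⟩

lemma BTensor.exists_extend_of_map_injective (f : N →ₗ[S] N')
    (hf : Function.Injective (BTensor.map R S C f)) (φ : N →ₗ[S] CharDual S C) :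
    ∃ ψ : N' →ₗ[S] CharDual S C, ψ ∘ₗ f = φ := by
  obtain ⟨χ, rfl⟩ := charAdj_surjective (R := R) φ
  obtain ⟨χ', rfl⟩ := exists_character_extend (BTensor.map R S C f).toAddMonoidHom hf χ
  exact ⟨charAdj χ', rfl⟩

/-- Exactness in the middle is tested on characters, where it becomes left exactness of Hom_S(-,
C⁺). -/
lemma BTensor.isShortExact {L M K : ModuleCat.{u} S} {f : L →ₗ[S] M} {g : M →ₗ[S] K}
    (h : IsShortExact f g) (hf : Function.Injective (BTensor.map R S C f)) :
    IsShortExact (L := ModuleCat.of R (BTensor R S C L)) (M := ModuleCat.of R (BTensor R S C M))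
      (K := ModuleCat.of R (BTensor R S C K)) (BTensor.map R S C f) (BTensor.map R S C g) := by
  have h0 : g ∘ₗ f = 0 := h.2.1.linearMap_comp_eq_zero
  refine ⟨hf, ?_, ?_⟩
  · refine exact_of_character (BTensor.map R S C f).toAddMonoidHom
      (BTensor.map R S C g).toAddMonoidHom (fun z => ?_) fun χ hχ => ?_
    · change (BTensor.map R S C g ∘ₗ BTensor.map R S C f) z = 0
      rw [← BTensor.map_comp, h0, BTensor.map_zero, LinearMap.zero_apply]
    · have hψ : ∃ ψ : K →ₗ[S] CharDual S C, ψ ∘ₗ g = charAdj χ := by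
        refine exists_factor_of_surjective g h.2.2 _ fun m hm => ?_
        obtain ⟨l, rfl⟩ := (h.2.1 m).1 hm
        exact CharDual.ext fun c => DFunLike.congr_fun hχ (btmul R S C c l)
      obtain ⟨ψ, hψ⟩ := hψ
      obtain ⟨χ', rfl⟩ := charAdj_surjective (R := R) ψ
      exact ⟨χ', charAdj_injective hψ⟩
  · intro z
    induction z using BTensor.induction with
    | h0 => exact ⟨0, LinearMap.map_zero _⟩
    | ht c x =>
      obtain ⟨y, rfl⟩ := h.2.2 x
      exact ⟨btmul R S C c y, rfl⟩
    | ha a b ha hb =>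
      obtain ⟨a, rfl⟩ := ha
      obtain ⟨b, rfl⟩ := hb
      exact ⟨a + b, LinearMap.map_add _ _ _⟩

end Adjunction

/-! ### Tor vanishing as Ext vanishing into the character module -/

section Tor

variable {R S C : Type u} [Ring R] [Ring S] [AddCommGroup C] [Module R C] [Module Sᵐᵒᵖ C]
  [SMulCommClass R Sᵐᵒᵖ C]

/-- `Ext` vanishing in terms of a projective resolution. -/
lemma extZero_iff_of_projectiveResolution {A : Type u} [Ring A] {N Y : ModuleCat.{u} A}
    (P : ProjectiveResolution N) (i : ℕ) :
    ExtZero N Y (i + 1) ↔ ∀ φ : P.complex.X (i + 1) ⟶ Y, P.complex.d (i + 2) (i + 1) ≫ φ = 0 →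
      ∃ ψ : P.complex.X i ⟶ Y, P.complex.d (i + 1) i ≫ ψ = φ := by
  refine ⟨fun h φ hφ => ?_, fun H => subsingleton_of_forall_eq 0 fun x => ?_⟩
  · exact (P.extMk_eq_zero_iff φ (i + 2) rfl hφ i rfl).1 (Subsingleton.elim _ _)
  · obtain ⟨φ, hφ, rfl⟩ := P.extMk_surjective x (i + 2) rfl
    exact (P.extMk_eq_zero_iff φ (i + 2) rfl hφ i rfl).2 (H φ hφ)

lemma subsingleton_torC_iff_exact {N : ModuleCat.{u} S} (P : ProjectiveResolution N) (i : ℕ) :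
    Subsingleton (TorC R S C (i + 1) N) ↔
      Function.Exact (BTensor.map R S C (P.complex.d (i + 2) (i + 1)).hom)
        (BTensor.map R S C (P.complex.d (i + 1) i).hom) := by
  have e := P.isoLeftDerivedObj (tensorFunctor R S C) (i + 1)
  rw [← ModuleCat.isZero_iff_subsingleton (M := TorC R S C (i + 1) N), TorC, e.isZero_iff]
  let K := ((tensorFunctor R S C).mapHomologicalComplex _).obj P.complex
  change Limits.IsZero (K.homology (i + 1)) ↔ _
  rw [← HomologicalComplex.exactAt_iff_isZero_homology,
    HomologicalComplex.exactAt_iff' K (i + 2) (i + 1) i (by simp) (by simp),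
    ShortComplex.ShortExact.moduleCat_exact_iff_function_exact]
  rfl

/-- `Tor_i^S(C, N) = 0` if and only if `Ext_S^i(N, Hom_ℤ(C, ℚ/ℤ)) = 0`. -/
lemma subsingleton_torC_iff {N : ModuleCat.{u} S} {i : ℕ} (hi : 1 ≤ i) :
    Subsingleton (TorC R S C i N) ↔ ExtZero N (ModuleCat.of S (CharDual S C)) i := by
  obtain ⟨i, rfl⟩ := Nat.exists_eq_add_of_le' hi
  let P := projectiveResolution N
  have hd : (P.complex.d (i + 1) i).hom ∘ₗ (P.complex.d (i + 2) (i + 1)).hom = 0 :=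
    congrArg ModuleCat.Hom.hom (P.complex.d_comp_d (i + 2) (i + 1) i)
  rw [subsingleton_torC_iff_exact P, extZero_iff_of_projectiveResolution P]
  refine ⟨fun h φ hφ => ?_, fun H => ?_⟩
  · obtain ⟨χ, hχ⟩ := charAdj_surjective (R := R) φ.hom
    have h0 : χ.comp (BTensor.map R S C (P.complex.d (i + 2) (i + 1)).hom).toAddMonoidHom = 0 := by
      refine charAdj_injective ?_
      rw [charAdj_comp, hχ]
      exact congrArg ModuleCat.Hom.hom hφ
    obtain ⟨χ', hχ'⟩ := exists_character_factor
      (BTensor.map R S C (P.complex.d (i + 1) i).hom).toAddMonoidHom χ (by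
        intro z hz
        obtain ⟨w, rfl⟩ := (h z).1 hz
        exact DFunLike.congr_fun h0 w)
    refine ⟨ModuleCat.ofHom (charAdj χ'), ModuleCat.hom_ext ?_⟩
    rw [← hχ, ← hχ']
    rfl
  · refine exact_of_character (BTensor.map R S C (P.complex.d (i + 2) (i + 1)).hom).toAddMonoidHom
      (BTensor.map R S C (P.complex.d (i + 1) i).hom).toAddMonoidHom (fun z => ?_) fun χ hχ => ?_
    · change (BTensor.map R S C _ ∘ₗ BTensor.map R S C _) z = 0
      rw [← BTensor.map_comp, hd, BTensor.map_zero, LinearMap.zero_apply]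
    · obtain ⟨ψ, hψ⟩ := H (ModuleCat.ofHom (charAdj χ)) (ModuleCat.hom_ext (by
        have := congrArg charAdj hχ
        rwa [charAdj_comp] at this))
      obtain ⟨χ', hχ'⟩ := charAdj_surjective (R := R) ψ.hom
      refine ⟨χ', charAdj_injective ?_⟩
      rw [charAdj_comp, hχ']
      exact congrArg ModuleCat.Hom.hom hψ

end Tor

/-! ### Degreewise finite resolutions; Ext and direct sums -/

section FiniteResolution

variable {A : Type u} [Ring A]

/-- `M` has a resolution by finitely generated projective modules. -/
def HasFiniteRes (M : ModuleCat.{u} A) : Prop :=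
  ∃ (P : ℕ → ModuleCat.{u} A) (d : ∀ i, P (i + 1) →ₗ[A] P i) (ε : P 0 →ₗ[A] M),
    (∀ i, Module.Finite A (P i)) ∧ (∀ i, Module.Projective A (P i)) ∧
    Function.Surjective ε ∧ Function.Exact (d 0) ε ∧ ∀ i, Function.Exact (d (i + 1)) (d i)

lemma HasDegreewiseFiniteResolution.hasFiniteRes {M : ModuleCat.{u} A}
    (h : HasDegreewiseFiniteResolution M) : HasFiniteRes M := by
  obtain ⟨P, hP⟩ := h
  let e := HomologicalComplex.singleObjXSelf (ComplexShape.down ℕ) 0 M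
  refine ⟨P.complex.X, fun i => (P.complex.d (i + 1) i).hom, (P.π.f 0 ≫ e.hom).hom, hP,
    fun i => (IsProjective.iff_projective (R := A) _).2 (P.projective i), ?_, ?_, fun i => ?_⟩
  · exact (ModuleCat.epi_iff_surjective _).1 (epi_comp (P.π.f 0) e.hom)
  · have h := (ShortComplex.ShortExact.moduleCat_exact_iff_function_exact _).1 P.exact₀
    intro x
    rw [← h x]
    change e.hom.hom ((P.π.f 0).hom x) = 0 ↔ _
    exact (map_eq_zero_iff e.hom.hom ((ModuleCat.mono_iff_injective e.hom).1 inferInstance))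
  · exact (ShortComplex.ShortExact.moduleCat_exact_iff_function_exact _).1 (P.exact_succ i)

/-- Dropping the first term resolves the kernel, so arguments can go by induction on the Ext degree
with D replaced by its first syzygy. -/
lemma HasFiniteRes.exists_ker {M : ModuleCat.{u} A} (h : HasFiniteRes M) :
    ∃ (Q : ModuleCat.{u} A) (p : Q →ₗ[A] M), Module.Finite A Q ∧ Module.Projective A Q ∧
      Function.Surjective p ∧ HasFiniteRes (ModuleCat.of A (LinearMap.ker p)) := by
  obtain ⟨P, d, ε, hf, hp, hε, h0, hd⟩ := h
  refine ⟨P 0, ε, hf 0, hp 0, hε, fun i => P (i + 1), fun i => d (i + 1),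
    (d 0).codRestrict (LinearMap.ker ε) fun x => h0.apply_apply_eq_zero x,
    fun i => hf _, fun i => hp _, ?_, fun x => ?_, fun i => hd _⟩
  · rintro ⟨y, hy⟩
    obtain ⟨x, rfl⟩ := (h0 y).1 hy
    exact ⟨x, rfl⟩
  · rw [← hd 0 x]
    exact Subtype.ext_iff

lemma HasFiniteRes.finite {M : ModuleCat.{u} A} (h : HasFiniteRes M) : Module.Finite A M := by
  obtain ⟨P, d, ε, hf, hp, hε, h0, hd⟩ := h
  have := hf 0
  exact Module.Finite.of_surjective ε hε

/-- `Ext^i(D, -)` commutes with direct sums, as far as vanishing is concerned, for modules with a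
degreewise finite projective resolution. -/
lemma HasFiniteRes.extZero_finsupp {D Y : ModuleCat.{u} A} (h : HasFiniteRes D)
    (hD : ∀ i, 1 ≤ i → ExtZero D Y i) (X : Type u) {i : ℕ} (hi : 1 ≤ i) :
    ExtZero D (ModuleCat.of A (X →₀ Y)) i := by
  induction i, hi using Nat.le_induction generalizing D with
  | base =>
    obtain ⟨Q, p, hQf, hQp, hp, hK⟩ := h.exists_ker
    have hs := isShortExact_ker p hp
    refine hs.extZero_one_left (extZero_of_projective le_rfl) fun φ => ?_
    have hfin := hK.finite
    obtain ⟨s, hs'⟩ := hfin.fg_top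
    classical
    -- Since the syzygy is finitely generated, φ has nonzero coordinates only at the finitely many
    -- indices in T. It therefore suffices to extend these coordinates one at a time and add them
    -- up.
    let T : Finset X := s.biUnion fun k => (φ k : X →₀ Y).support
    have hT : ∀ x ∉ T, (Finsupp.lapply x : (X →₀ Y) →ₗ[ℕ] Y).toAddMonoidHom.comp
        φ.toAddMonoidHom = 0 := by
      intro x hx
      have : (Finsupp.lapply x : (X →₀ Y) →ₗ[A] Y) ∘ₗ φ = 0 := by
        refine LinearMap.ext_on_range (v := fun k : s => (k : LinearMap.ker p))
          (by simpa using hs') fun k => ?_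
        by_contra hne
        exact hx (Finset.mem_biUnion.2 ⟨k, k.2, Finsupp.mem_support_iff.2 hne⟩)
      exact AddMonoidHom.ext fun k => LinearMap.congr_fun this k
    choose ψ hψ using fun x : X => hs.exists_extend (hD 1 le_rfl)
      ((Finsupp.lapply x : (X →₀ Y) →ₗ[A] Y) ∘ₗ φ)
    refine ⟨∑ x ∈ T, Finsupp.lsingle x ∘ₗ ψ x, ?_⟩
    refine LinearMap.ext fun k => Finsupp.ext fun x => ?_
    change (((∑ x ∈ T, Finsupp.lsingle x ∘ₗ ψ x : Q →ₗ[A] (X →₀ Y)) k.1 : X →₀ Y)) x =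
      (φ k : X →₀ Y) x
    have h2 : ∀ y, ψ y k.1 = (φ k : X →₀ Y) y := fun y => LinearMap.congr_fun (hψ y) k
    rw [LinearMap.sum_apply, Finsupp.finsetSum_apply]
    simp only [LinearMap.comp_apply, Finsupp.lsingle_apply, Finsupp.single_apply, h2]
    rw [Finset.sum_ite_eq' T x]
    split_ifs with hx
    · rfl
    · exact (DFunLike.congr_fun (hT x hx) k).symm
  | succ i hi ih =>
    obtain ⟨Q, p, hQf, hQp, hp, hK⟩ := h.exists_ker
    have hs := isShortExact_ker p hp
    exact hs.extZero_left₃ (ih hK fun j hj => hs.extZero_left₁ (extZero_of_projective hj)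
      (hD _ (by lia))) (extZero_of_projective (by lia))

end FiniteResolution

/-! ### The Auslander class through Ext; retracts -/

section Retract

variable {R S C : Type u} [Ring R] [Ring S] [AddCommGroup C] [Module R C] [Module Sᵐᵒᵖ C]
  [SMulCommClass R Sᵐᵒᵖ C]

lemma inAuslander_iff {N : ModuleCat.{u} S} : InAuslander R S C N ↔
    (∀ i : ℕ, 1 ≤ i → ExtZero N (ModuleCat.of S (CharDual S C)) i) ∧
    (∀ i : ℕ, 1 ≤ i → ExtZero (ModuleCat.of R C) (ModuleCat.of R (BTensor R S C N)) i) ∧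
    Function.Bijective (muC R S C N) :=
  ⟨fun h => ⟨fun i hi => (subsingleton_torC_iff hi).1 (h.1 i hi), h.2, h.3⟩,
    fun h => ⟨fun i hi => (subsingleton_torC_iff hi).2 (h.1 i hi), h.2.1, h.2.2⟩⟩

lemma InAuslander.extZero {N : ModuleCat.{u} S} (h : InAuslander R S C N) {i : ℕ} (hi : 1 ≤ i) :
    ExtZero N (ModuleCat.of S (CharDual S C)) i := (inAuslander_iff.1 h).1 i hi

lemma InAuslander.of_retract {X Y : ModuleCat.{u} S} (hY : InAuslander R S C Y) (s : X →ₗ[S] Y)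
    (r : Y →ₗ[S] X) (h : r ∘ₗ s = LinearMap.id) : InAuslander R S C X := by
  have hrs : ∀ x, r (s x) = x := fun x => LinearMap.congr_fun h x
  have hF : BTensor.map R S C r ∘ₗ BTensor.map R S C s = LinearMap.id := by
    rw [← BTensor.map_comp, h, BTensor.map_id]
  have hF' : ∀ z, BTensor.map R S C r (BTensor.map R S C s z) = z :=
    fun z => LinearMap.congr_fun hF z
  rw [inAuslander_iff] at hY ⊢
  refine ⟨fun i hi => extZero_of_retract_left s r h (hY.1 i hi), fun i hi =>
    extZero_of_retract_right (X := ModuleCat.of R (BTensor R S C X))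
      (Y := ModuleCat.of R (BTensor R S C Y)) _ _ hF (hY.2.1 i hi), fun x y hxy => ?_, fun φ => ?_⟩
  · have := hY.2.2.1 (a₁ := s x) (a₂ := s y) (by
      rw [← muC_naturality, ← muC_naturality, hxy])
    rw [← hrs x, this, hrs]
  · obtain ⟨y, hy⟩ := hY.2.2.2 (HomC.map (BTensor.map R S C s) φ)
    refine ⟨r y, ?_⟩
    rw [← muC_naturality, hy]
    exact HomC.ext fun c => hF' _

lemma InAuslander.of_equiv {X Y : ModuleCat.{u} S} (hY : InAuslander R S C Y) (e : X ≃ₗ[S] Y) :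
    InAuslander R S C X :=
  hY.of_retract e.toLinearMap e.symm.toLinearMap (by ext; simp)

end Retract

/-! ### Projective modules lie in the Auslander class -/

section Projective

variable {R S C : Type u} [Ring R] [Ring S] [AddCommGroup C] [Module R C] [Module Sᵐᵒᵖ C]
  [SMulCommClass R Sᵐᵒᵖ C]

/-- The map `C ⊗_S S^(X) → C^(X)`. -/
noncomputable def tensorFree (X : Type u) : BTensor R S C (X →₀ S) →ₗ[R] (X →₀ C) :=
  homAdjSymm
    { toFun := fun v => HomC.ofLin
        { toFun := fun c => v.mapRange (fun s => op s • c) (by simp)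
          map_add' := fun c d => by ext; simp
          map_smul' := fun r c => by ext; simp [smul_comm r] }
      map_add' := fun v w => HomC.ext fun c => Finsupp.ext fun x => add_smul (op (v x)) (op (w x)) c
      map_smul' := fun s v => HomC.ext fun c => Finsupp.ext fun x =>
        mul_smul (op (v x)) (op s) c }

lemma tensorFree_btmul (X : Type u) (c : C) (v : X →₀ S) (x : X) :
    tensorFree X (btmul R S C c v) x = op (v x) • c := rfl

lemma tensorFree_bijective (X : Type u) :
    Function.Bijective (tensorFree X : BTensor R S C (X →₀ S) →ₗ[R] (X →₀ C)) := by
  let inv : (X →₀ C) →ₗ[R] BTensor R S C (X →₀ S) := Finsupp.lsum ℕ fun x =>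
    (muC R S C (X →₀ S) (Finsupp.single x 1)).toLin
  have hinv : ∀ x c, inv (Finsupp.single x c) = btmul R S C c (Finsupp.single x 1) := fun x c => by
    simp only [inv, Finsupp.lsum_single]; rfl
  have h1 : inv ∘ₗ tensorFree X = LinearMap.id := by
    refine BTensor.hom_ext fun c v => ?_
    induction v using Finsupp.induction_linear with
    | zero =>
      have : btmul R S C c (0 : X →₀ S) = 0 := by
        simpa using btmul_add R S C c (0 : X →₀ S) 0
      rw [this, map_zero, map_zero]
    | add v w hv hw => rw [btmul_add, map_add, map_add, hv, hw]
    | single x s =>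
      have : tensorFree X (btmul R S C c (Finsupp.single x s)) = Finsupp.single x (op s • c) := by
        ext y
        classical
        rw [tensorFree_btmul, Finsupp.single_apply, Finsupp.single_apply]
        split_ifs <;> simp
      rw [LinearMap.comp_apply, this, hinv, btmul_smul]
      simp
  have h2 : tensorFree X ∘ₗ inv = LinearMap.id := by
    refine Finsupp.lhom_ext fun x c => ?_
    rw [LinearMap.comp_apply, hinv]
    ext y
    classical
    rw [tensorFree_btmul, LinearMap.id_apply, Finsupp.single_apply, Finsupp.single_apply]
    split_ifs <;> simp
  exact ⟨Function.LeftInverse.injective (g := inv) fun z => LinearMap.congr_fun h1 z,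
    Function.RightInverse.surjective (g := inv) fun z => LinearMap.congr_fun h2 z⟩

variable (hC : IsSemidualizing R S C)
include hC

/-- Since C ⊗ S^(X) ≅ C^(X), the Ext condition follows from Ext(C, C) = 0 and finiteness of the left
resolution, and the condition on μ from the homothety S ≅ Hom_R(C, C). -/
lemma inAuslander_free (X : Type u) : InAuslander R S C (ModuleCat.of S (X →₀ S)) := by
  let e := LinearEquiv.ofBijective (tensorFree (R := R) (S := S) (C := C) X) (tensorFree_bijective X)
  have hfin := hC.finite_left.hasFiniteRes
  rw [inAuslander_iff]
  refine ⟨fun i hi => extZero_of_projective hi, fun i hi => ?_, fun v w hvw => ?_, fun φ => ?_⟩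
  · exact extZero_congr_right (X := ModuleCat.of R (BTensor R S C (X →₀ S)))
      (Y := ModuleCat.of R (X →₀ C)) e (hfin.extZero_finsupp hC.ext_left X hi)
  · refine Finsupp.ext fun x => hC.homothety_right.1 (LinearMap.ext fun c => ?_)
    exact congrArg (fun f : HomC R S C (BTensor R S C (X →₀ S)) =>
      tensorFree X (f.toLin c) x) hvw
  · have hf : Module.Finite R C := hfin.finite
    obtain ⟨T, hT⟩ := hf.fg_top
    -- Each coordinate of φ is an R-endomorphism of C, hence right multiplication by some σ x. As C
    -- is finitely generated over R, only finitely many σ x are nonzero.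
    choose σ hσ using fun x : X => hC.homothety_right.2
      ((Finsupp.lapply x : (X →₀ C) →ₗ[R] C) ∘ₗ tensorFree X ∘ₗ φ.toLin)
    have hσ' : ∀ x c, op (σ x) • c = tensorFree X (φ.toLin c) x := fun x c =>
      LinearMap.congr_fun (hσ x) c
    classical
    let v : X →₀ S := Finsupp.onFinset
      (T.biUnion fun c => (tensorFree X (φ.toLin c)).support) σ (by
        intro x hx
        by_contra hne
        refine hx (hC.homothety_right.1 ?_)
        rw [hσ]
        refine LinearMap.ext_on_range (v := fun k : T => (k : C)) (by simpa using hT) fun k => ?_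
        have : tensorFree X (φ.toLin k) x = 0 := by
          by_contra h0
          exact hne (Finset.mem_biUnion.2 ⟨k, k.2, Finsupp.mem_support_iff.2 h0⟩)
        change tensorFree X (φ.toLin k) x = op (0 : S) • (k : C)
        rw [this, op_zero, zero_smul])
    refine ⟨v, HomC.ext fun c => e.injective (Finsupp.ext fun x => ?_)⟩
    exact hσ' x c

lemma inAuslander_of_projective (P : ModuleCat.{u} S) [Module.Projective S P] :
    InAuslander R S C P := by
  obtain ⟨s, hs⟩ := (Module.projective_def' (R := S) (P := P)).1 inferInstance
  exact (inAuslander_free hC P).of_retract s _ hs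

end Projective

/-! ### Tensor evaluation, after passing to characters -/

section Evaluation

variable {R S C : Type u} [Ring R] [Ring S] [AddCommGroup C] [Module R C] [Module Sᵐᵒᵖ C]
  [SMulCommClass R Sᵐᵒᵖ C] [SMulCommClass Sᵐᵒᵖ R C]
variable {D D' : Type u} [AddCommGroup D] [Module Sᵐᵒᵖ D] [AddCommGroup D'] [Module Sᵐᵒᵖ D']
variable {I : Type u} [AddCommGroup I] [Module R I]

/-- Evaluation at `d` on `Hom_{Sᵒᵖ}(D, C)`. -/
def evalAt (R : Type u) [Ring R] [Module R C] [SMulCommClass Sᵐᵒᵖ R C] (d : D) :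
    (D →ₗ[Sᵐᵒᵖ] C) →ₗ[R] C where
  toFun h := h d
  map_add' _ _ := rfl
  map_smul' _ _ := rfl

/-- Precomposition with `a` on `Hom_{Sᵒᵖ}(-, C)`. -/
def precompC (R C : Type u) [Ring R] [AddCommGroup C] [Module R C] [Module Sᵐᵒᵖ C]
    [SMulCommClass Sᵐᵒᵖ R C] (a : D →ₗ[Sᵐᵒᵖ] D') : (D' →ₗ[Sᵐᵒᵖ] C) →ₗ[R] (D →ₗ[Sᵐᵒᵖ] C) where
  toFun h := h ∘ₗ a
  map_add' _ _ := rfl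
  map_smul' _ _ := rfl

/-- The map `Hom_R(Hom_{Sᵒᵖ}(D, C), I) → Hom_R(Hom_{Sᵒᵖ}(D', C), I)` induced by `a : D → D'`. -/
def bidualMap (R C I : Type u) [Ring R] [AddCommGroup C] [Module R C] [Module Sᵐᵒᵖ C]
    [SMulCommClass Sᵐᵒᵖ R C] [AddCommGroup I] [Module R I] (a : D →ₗ[Sᵐᵒᵖ] D') :
    ((D →ₗ[Sᵐᵒᵖ] C) →ₗ[R] I) →+ ((D' →ₗ[Sᵐᵒᵖ] C) →ₗ[R] I) where
  toFun t := t ∘ₗ precompC R C a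
  map_zero' := rfl
  map_add' _ _ := rfl

/-- The dual of the tensor evaluation map `D ⊗_S Hom_R(C, I) → Hom_R(Hom_{Sᵒᵖ}(D, C), I)`. -/
def tensorEvalDual (χ : ((D →ₗ[Sᵐᵒᵖ] C) →ₗ[R] I) →+ AddCircle (1 : ℚ)) :
    HomC R S C I →ₗ[S] CharDual S D where
  toFun f := CharDual.ofHom (AddMonoidHom.mk' (fun d => χ (f.toLin ∘ₗ evalAt R d)) fun d e => by
    rw [← map_add]
    exact congrArg χ (LinearMap.ext fun h =>
      (congrArg f.toLin (h.map_add d e)).trans (map_add f.toLin _ _)))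
  map_add' f g := CharDual.ext fun d => map_add χ (f.toLin ∘ₗ evalAt R d) (g.toLin ∘ₗ evalAt R d)
  map_smul' s f := CharDual.ext fun d => congrArg χ (LinearMap.ext fun h =>
    congrArg f.toLin (h.map_smul (op s) d).symm)

lemma tensorEvalDual_naturality (a : D →ₗ[Sᵐᵒᵖ] D')
    (χ : ((D' →ₗ[Sᵐᵒᵖ] C) →ₗ[R] I) →+ AddCircle (1 : ℚ)) :
    tensorEvalDual (χ.comp (bidualMap R C I a)) = CharDual.map a ∘ₗ tensorEvalDual χ := rfl

lemma tensorEvalDual_sub (χ ψ : ((D →ₗ[Sᵐᵒᵖ] C) →ₗ[R] I) →+ AddCircle (1 : ℚ)) :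
    tensorEvalDual (χ - ψ) = tensorEvalDual χ - tensorEvalDual ψ := rfl

lemma tensorEvalDual_zero :
    tensorEvalDual (0 : ((D →ₗ[Sᵐᵒᵖ] C) →ₗ[R] I) →+ AddCircle (1 : ℚ)) = 0 := rfl

/-- A finitely generated projective module has a finite dual basis. -/
lemma exists_finite_dual_basis (A : Type u) [Ring A] (Q : Type u) [AddCommGroup Q] [Module A Q]
    [Module.Finite A Q] [Module.Projective A Q] :
    ∃ (n : ℕ) (q : Fin n → Q) (φ : Fin n → Q →ₗ[A] A), ∀ x, ∑ j, φ j x • q j = x := by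
  obtain ⟨n, f, hf⟩ := Module.Finite.exists_fin' A Q
  obtain ⟨g, hg⟩ := Module.projective_lifting_property f LinearMap.id hf
  refine ⟨n, fun j => f (Pi.single j 1), fun j => LinearMap.proj j ∘ₗ g, fun x => ?_⟩
  have h : f (g x) = x := LinearMap.congr_fun hg x
  conv_rhs => rw [← h, ← (Pi.basisFun A (Fin n)).sum_repr (g x), map_sum]
  simp [Pi.basisFun_apply]

/-- The homomorphism `d ↦ c * φ d` of right `S`-modules. -/
def smulFunctional (φ : D →ₗ[Sᵐᵒᵖ] Sᵐᵒᵖ) : C →ₗ[R] (D →ₗ[Sᵐᵒᵖ] C) where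
  toFun c := φ.smulRight c
  map_add' c e := by ext d; simp
  map_smul' r c := by
    ext d
    exact smul_comm (φ d) r c

lemma tensorEvalDual_bijective_of_projective [Module.Finite Sᵐᵒᵖ D] [Module.Projective Sᵐᵒᵖ D] :
    Function.Bijective (tensorEvalDual :
      (((D →ₗ[Sᵐᵒᵖ] C) →ₗ[R] I) →+ AddCircle (1 : ℚ)) → HomC R S C I →ₗ[S] CharDual S D) := by
  obtain ⟨n, q, φ, hq⟩ := exists_finite_dual_basis Sᵐᵒᵖ D
  have hh : ∀ h : D →ₗ[Sᵐᵒᵖ] C, ∑ j, smulFunctional (R := R) (φ j) (h (q j)) = h := by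
    intro h
    ext d
    rw [LinearMap.sum_apply]
    conv_rhs => rw [← hq d, map_sum]
    exact Finset.sum_congr rfl fun j _ => (h.map_smul (φ j d) (q j)).symm
  -- F t j is the coordinate of t at the dual basis functional φ j; t is recovered by composing
  -- these coordinates with evaluation at the q j and summing.
  let F : ((D →ₗ[Sᵐᵒᵖ] C) →ₗ[R] I) → Fin n → HomC R S C I := fun t j =>
    HomC.ofLin (t ∘ₗ smulFunctional (φ j))
  have ht : ∀ t : (D →ₗ[Sᵐᵒᵖ] C) →ₗ[R] I, ∑ j, (F t j).toLin ∘ₗ evalAt R (q j) = t := by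
    intro t
    ext h
    rw [LinearMap.sum_apply]
    conv_rhs => rw [← hh h, map_sum]
    rfl
  refine ⟨fun χ ψ hχ => AddMonoidHom.ext fun t => ?_, fun g => ?_⟩
  · rw [← ht t, map_sum, map_sum]
    exact Finset.sum_congr rfl fun j _ =>
      congrArg (fun l : HomC R S C I →ₗ[S] CharDual S D => (l (F t j)).toHom (q j)) hχ
  · refine ⟨AddMonoidHom.mk' (fun t => ∑ j, (g (F t j)).toHom (q j)) fun t t' => ?_, ?_⟩
    · rw [← Finset.sum_add_distrib]
      exact Finset.sum_congr rfl fun j _ =>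
        congrArg (fun c : CharDual S D => c.toHom (q j)) (map_add g (F t j) (F t' j))
    · refine LinearMap.ext fun f => CharDual.ext fun d => ?_
      change ∑ j, (g (F (f.toLin ∘ₗ evalAt R d) j)).toHom (q j) = _
      conv_rhs => rw [← hq d, map_sum]
      exact Finset.sum_congr rfl fun j _ =>
        congrArg (fun c : CharDual S D => c.toHom (q j)) (g.map_smul (unop (φ j d)) f)

end Evaluation

/-! ### C-injective modules lie in the Auslander class -/

section EvaluationBijective

variable {R S C : Type u} [Ring R] [Ring S] [AddCommGroup C] [Module R C] [Module Sᵐᵒᵖ C]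
  [SMulCommClass R Sᵐᵒᵖ C] [SMulCommClass Sᵐᵒᵖ R C]
variable {I : ModuleCat.{u} R} [hI : Injective I]

omit [SMulCommClass R Sᵐᵒᵖ C] in
lemma bidualMap_surjective {D D' : Type u} [AddCommGroup D] [Module Sᵐᵒᵖ D] [AddCommGroup D']
    [Module Sᵐᵒᵖ D'] (a : D →ₗ[Sᵐᵒᵖ] D') (ha : Function.Surjective a) :
    Function.Surjective (bidualMap R C I a) := fun t =>
  exists_extend_of_injective (precompC R C a)
    (fun _ _ h => LinearMap.ext fun d => by
      obtain ⟨d, rfl⟩ := ha d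
      exact LinearMap.congr_fun h d) t

omit [SMulCommClass R Sᵐᵒᵖ C] in
lemma bidualMap_exact {L M K : ModuleCat.{u} Sᵐᵒᵖ} {f : L →ₗ[Sᵐᵒᵖ] M} {g : M →ₗ[Sᵐᵒᵖ] K}
    (h : IsShortExact f g) (t : (M →ₗ[Sᵐᵒᵖ] C) →ₗ[R] I) (ht : bidualMap R C I g t = 0) :
    ∃ t', bidualMap R C I f t' = t := by
  refine exists_factor_of_injective (precompC R C f) t fun φ hφ => ?_
  obtain ⟨ψ, rfl⟩ := exists_factor_of_surjective g h.2.2 φ fun m hm => by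
    obtain ⟨l, rfl⟩ := (h.2.1 m).1 hm
    exact LinearMap.congr_fun hφ l
  exact LinearMap.congr_fun ht ψ

/-- This is the dual form of surjectivity of tensor evaluation; a finite free module mapping onto D
reduces it to the projective case. -/
lemma tensorEvalDual_injective {D : ModuleCat.{u} Sᵐᵒᵖ} (hD : Module.Finite Sᵐᵒᵖ D) :
    Function.Injective (tensorEvalDual :
      (((D →ₗ[Sᵐᵒᵖ] C) →ₗ[R] I) →+ AddCircle (1 : ℚ)) → HomC R S C I →ₗ[S] CharDual S D) := by
  obtain ⟨n, p, hp⟩ := Module.Finite.exists_fin' Sᵐᵒᵖ D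
  have key : ∀ χ : ((D →ₗ[Sᵐᵒᵖ] C) →ₗ[R] I) →+ AddCircle (1 : ℚ),
      tensorEvalDual (S := S) χ = 0 → χ = 0 := by
    intro χ hχ
    have h1 : χ.comp (bidualMap R C I p) = 0 := by
      refine tensorEvalDual_bijective_of_projective.1 ?_
      rw [tensorEvalDual_naturality, hχ, LinearMap.comp_zero, tensorEvalDual_zero]
    ext t
    obtain ⟨t, rfl⟩ := bidualMap_surjective p hp t
    exact DFunLike.congr_fun h1 t
  intro χ ψ h
  exact sub_eq_zero.1 (key _ (by rw [tensorEvalDual_sub, h, sub_self]))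

lemma tensorEvalDual_bijective {D : ModuleCat.{u} Sᵐᵒᵖ} (hD : HasFiniteRes D) :
    Function.Bijective (tensorEvalDual :
      (((D →ₗ[Sᵐᵒᵖ] C) →ₗ[R] I) →+ AddCircle (1 : ℚ)) → HomC R S C I →ₗ[S] CharDual S D) := by
  refine ⟨tensorEvalDual_injective hD.finite, fun g => ?_⟩
  obtain ⟨Q, p, hQf, hQp, hp, hK⟩ := hD.exists_ker
  have hs := isShortExact_ker p hp
  obtain ⟨χ, hχ⟩ := tensorEvalDual_bijective_of_projective.2 (CharDual.map p ∘ₗ g)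
  -- Injectivity for the finitely generated syzygy shows that χ kills the bidual of ker p. By
  -- `bidualMap_exact` it then kills the kernel of `bidualMap R C I p`, so it descends to the bidual
  -- of D.
  have h0 : χ.comp (bidualMap R C I (LinearMap.ker p).subtype) = 0 := by
    refine tensorEvalDual_injective hK.finite ?_
    rw [tensorEvalDual_zero]
    refine (tensorEvalDual_naturality (LinearMap.ker p).subtype χ).trans ?_
    rw [hχ]
    refine LinearMap.ext fun f => CharDual.ext fun k => ?_
    change (g f).toHom (p k.1) = 0
    rw [LinearMap.mem_ker.1 k.2, map_zero]
  obtain ⟨χ', hχ'⟩ := exists_character_factor (bidualMap R C I p) χ (by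
    intro t ht
    obtain ⟨t', rfl⟩ := bidualMap_exact hs t ht
    exact DFunLike.congr_fun h0 t')
  refine ⟨χ', ?_⟩
  rw [← hχ', tensorEvalDual_naturality] at hχ
  refine LinearMap.ext fun f => (CharDual.isShortExact hs).1 ?_
  exact LinearMap.congr_fun hχ f

/-- For D = C this is the vanishing of Tor_i(C, Hom_R(C, I)). The short exact sequences 0 → D⁺ → Q⁺
→ K⁺ → 0, with Q⁺ injective, shift the degree down to 1. -/
lemma extZero_homC_charDual {D : ModuleCat.{u} Sᵐᵒᵖ} (hD : HasFiniteRes D)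
    (hDC : ∀ i, 1 ≤ i → ExtZero D (ModuleCat.of Sᵐᵒᵖ C) i) {i : ℕ} (hi : 1 ≤ i) :
    ExtZero (ModuleCat.of S (HomC R S C I)) (ModuleCat.of S (CharDual S D)) i := by
  induction i, hi using Nat.le_induction generalizing D with
  | base =>
    obtain ⟨Q, p, hQf, hQp, hp, hK⟩ := hD.exists_ker
    have hs := isShortExact_ker p hp
    have hinj : Injective (ModuleCat.of S (CharDual S Q)) := CharDual.injective
    refine (CharDual.isShortExact hs).extZero_one_right (extZero_of_injective le_rfl) fun g => ?_
    obtain ⟨χ', rfl⟩ := (tensorEvalDual_bijective hK).2 g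
    -- Ext^1(D, C) = 0 lets maps K → C extend to Q, so the map of biduals is injective and χ'
    -- extends; the extension yields the lift to Q⁺.
    obtain ⟨χ, rfl⟩ := exists_character_extend
      (bidualMap R C I (LinearMap.ker p).subtype) (fun t t' h => LinearMap.ext fun φ => by
        obtain ⟨ψ, rfl⟩ := hs.exists_extend (hDC 1 le_rfl) φ
        exact LinearMap.congr_fun h ψ) χ'
    exact ⟨tensorEvalDual χ, rfl⟩
  | succ i hi ih =>
    obtain ⟨Q, p, hQf, hQp, hp, hK⟩ := hD.exists_ker
    have hs := isShortExact_ker p hp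
    have hinj : Injective (ModuleCat.of S (CharDual S Q)) := CharDual.injective
    exact (CharDual.isShortExact hs).extZero_right₁ (extZero_of_injective (by lia))
      (ih hK fun j hj => hs.extZero_left₁ (extZero_of_projective hj) (hDC _ (by lia)))

/-- The evaluation map `C ⊗_S Hom_R(C, I) → I`. -/
def evalC (R S C I : Type u) [Ring R] [Ring S] [AddCommGroup C] [Module R C] [Module Sᵐᵒᵖ C]
    [SMulCommClass R Sᵐᵒᵖ C] [AddCommGroup I] [Module R I] :
    BTensor R S C (HomC R S C I) →ₗ[R] I :=
  homAdjSymm LinearMap.id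

omit [SMulCommClass Sᵐᵒᵖ R C]

variable (hC : IsSemidualizing R S C)
include hC

/-- The homothety R ≅ Hom_{Sᵒᵖ}(C, C) identifies I with the bidual of C. Under this identification
`tensorEvalDual` at D = C is the character dual of `evalC`, so its bijectivity gives the claim. -/
lemma evalC_bijective : Function.Bijective (evalC R S C I) := by
  have := SMulCommClass.symm R Sᵐᵒᵖ C
  have hfin := hC.finite_right.hasFiniteRes
  let E : R ≃ₗ[R] (C →ₗ[Sᵐᵒᵖ] C) := LinearEquiv.ofBijective
    { toFun := leftMul R S C
      map_add' := fun r s => LinearMap.ext fun c => add_smul r s c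
      map_smul' := fun r s => LinearMap.ext fun c => by exact mul_smul r s c } hC.homothety_left
  let e : I ≃+ ((C →ₗ[Sᵐᵒᵖ] C) →ₗ[R] I) := AddEquiv.mk'
    { toFun := fun y => LinearMap.toSpanSingleton R I y ∘ₗ E.symm.toLinearMap
      invFun := fun t => t (E 1)
      left_inv := fun y => by
        change E.symm (E 1) • y = y
        rw [E.symm_apply_apply, one_smul]
      right_inv := fun t => LinearMap.ext fun h => by
        change E.symm h • t (E 1) = t h
        rw [← map_smul, ← map_smul, smul_eq_mul, mul_one, E.apply_symm_apply] }
    fun x y => LinearMap.ext fun h => smul_add _ x y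
  have he : ∀ (f : HomC R S C I) (c : C), e.symm (f.toLin ∘ₗ evalAt R c) = f.toLin c := by
    intro f c
    change f.toLin ((1 : R) • c) = _
    rw [one_smul]
  have key : ∀ ξ : I →+ AddCircle (1 : ℚ),
      charAdj (ξ.comp (evalC R S C I).toAddMonoidHom) =
        tensorEvalDual (D := C) (ξ.comp e.symm.toAddMonoidHom) := fun ξ =>
    LinearMap.ext fun f => CharDual.ext fun c => congrArg ξ (he f c).symm
  constructor
  · refine injective_of_character (evalC R S C I).toAddMonoidHom fun χ => ?_
    obtain ⟨χ', hχ'⟩ := (tensorEvalDual_bijective hfin).2 (charAdj χ)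
    refine ⟨χ'.comp e.toAddMonoidHom, charAdj_injective ?_⟩
    rw [key, ← hχ']
    congr 1
    ext t
    exact congrArg χ' (e.apply_symm_apply t)
  · refine surjective_of_character (evalC R S C I).toAddMonoidHom fun ξ hξ => ?_
    have h := key ξ
    rw [hξ, charAdj_zero] at h
    have h2 := (tensorEvalDual_bijective hfin).1 (a₂ := 0) h.symm
    ext y
    have h3 := DFunLike.congr_fun h2 (e y)
    change ξ (e.symm (e y)) = 0 at h3
    rwa [e.symm_apply_apply] at h3

lemma inAuslander_homC : InAuslander R S C (ModuleCat.of S (HomC R S C I)) := by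
  have := SMulCommClass.symm R Sᵐᵒᵖ C
  let e := LinearEquiv.ofBijective (evalC R S C I) (evalC_bijective hC)
  have hfin := hC.finite_right.hasFiniteRes
  rw [inAuslander_iff]
  refine ⟨fun i hi => extZero_homC_charDual hfin hC.ext_right hi, fun i hi =>
    extZero_congr_right (X := ModuleCat.of R (BTensor R S C (HomC R S C I))) e
      (extZero_of_injective hi), fun f g h => ?_, fun φ => ⟨HomC.map e.toLinearMap φ, ?_⟩⟩
  -- By the triangle identity, Hom_R(C, e) is a left inverse of μ, definitionally.
  · exact congrArg (HomC.map e.toLinearMap) h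
  · exact HomC.ext fun c => e.injective rfl

omit hI in
lemma IsCInjective.inAuslander {U : ModuleCat.{u} S} (hU : IsCInjective R S C U) :
    InAuslander R S C U := by
  obtain ⟨I, hI, ⟨e⟩⟩ := hU
  exact (inAuslander_homC hC).of_equiv e

end EvaluationBijective

/-! ### Closure properties and embeddings into C-injectives -/

section Closure

variable {R S C : Type u} [Ring R] [Ring S] [AddCommGroup C] [Module R C] [Module Sᵐᵒᵖ C]
  [SMulCommClass R Sᵐᵒᵖ C]

lemma IsShortExact.exists_lift_of_comp_eq_zero {A : Type u} [Ring A] {L M K : ModuleCat.{u} A}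
    {f : L →ₗ[A] M} {g : M →ₗ[A] K} (h : IsShortExact f g) {X : Type u} [AddCommGroup X]
    [Module A X] (φ : X →ₗ[A] M) (hφ : ∀ x, g (φ x) = 0) : ∃ φ' : X →ₗ[A] L, f ∘ₗ φ' = φ := by
  refine ⟨(LinearEquiv.ofInjective f h.1).symm.toLinearMap ∘ₗ
    φ.codRestrict (LinearMap.range f) fun x => (h.2.1 _).1 (hφ x), LinearMap.ext fun x => ?_⟩
  exact congrArg Subtype.val ((LinearEquiv.ofInjective f h.1).apply_symm_apply
    ⟨φ x, (h.2.1 _).1 (hφ x)⟩)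

variable {L M K : ModuleCat.{u} S} {f : L →ₗ[S] M} {g : M →ₗ[S] K}

namespace IsShortExact

lemma tensor_injective (h : IsShortExact f g)
    (hK : ExtZero K (ModuleCat.of S (CharDual S C)) 1) :
    Function.Injective (BTensor.map R S C f) :=
  BTensor.map_injective_of_extend f fun φ => h.exists_extend hK φ

/-- The Auslander class is closed under extensions. -/
lemma inAuslander₂ (h : IsShortExact f g) (hL : InAuslander R S C L) (hK : InAuslander R S C K) :
    InAuslander R S C M := by
  have hT := BTensor.isShortExact h (h.tensor_injective (R := R) (hK.extZero le_rfl))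
  rw [inAuslander_iff]
  refine ⟨fun i hi => h.extZero_left₂ (hL.extZero hi) (hK.extZero hi),
    fun i hi => hT.extZero_right₂ (hL.2 i hi) (hK.2 i hi), ?_, fun φ => ?_⟩
  · refine (injective_iff_map_eq_zero _).2 fun m hm => ?_
    have h1 : muC R S C K (g m) = 0 := by rw [← muC_naturality, hm, map_zero]
    obtain ⟨l, rfl⟩ := (h.2.1 m).1 ((map_eq_zero_iff _ hK.3.1).1 h1)
    have h2 : muC R S C L l = 0 := HomC.ext fun c => hT.1
      ((congrArg (fun φ : HomC R S C (BTensor R S C M) => φ.toLin c) hm).trans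
        (map_zero (BTensor.map R S C f)).symm)
    rw [(map_eq_zero_iff _ hL.3.1).1 h2, map_zero]
  · obtain ⟨k, hk⟩ := hK.3.2 (HomC.map (BTensor.map R S C g) φ)
    obtain ⟨m, rfl⟩ := h.2.2 k
    -- After subtracting μ m the map dies in C ⊗ K, so it comes from C ⊗ L and is handled by
    -- surjectivity of μ_L.
    obtain ⟨φ', hφ'⟩ := hT.exists_lift_of_comp_eq_zero (φ.toLin - (muC R S C M m).toLin) (by
      intro c
      have := congrArg (fun ψ : HomC R S C (BTensor R S C K) => ψ.toLin c) hk
      rw [LinearMap.sub_apply, map_sub, sub_eq_zero]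
      exact this.symm)
    obtain ⟨l, hl⟩ := hL.3.2 (HomC.ofLin φ')
    refine ⟨m + f l, HomC.ext fun c => ?_⟩
    have h1 : (muC R S C M (f l)).toLin c = φ.toLin c - (muC R S C M m).toLin c := by
      rw [← muC_naturality, hl]
      exact LinearMap.congr_fun hφ' c
    have h2 : (muC R S C M (m + f l)).toLin c =
      (muC R S C M m).toLin c + (muC R S C M (f l)).toLin c := btmul_add R S C c m (f l)
    rw [h2, h1, add_sub_cancel]

/-- The Auslander class is closed under those cokernels of monomorphisms that have vanishing
`Tor_1`. -/
lemma inAuslander₃ (h : IsShortExact f g) (hL : InAuslander R S C L) (hM : InAuslander R S C M)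
    (hK : ExtZero K (ModuleCat.of S (CharDual S C)) 1) : InAuslander R S C K := by
  have hT := BTensor.isShortExact h (h.tensor_injective (R := R) hK)
  rw [inAuslander_iff]
  refine ⟨fun i hi => ?_, fun i hi => hT.extZero_right₃ (hL.2 _ (by lia)) (hM.2 i hi), ?_,
    fun φ => ?_⟩
  · obtain rfl | hi := hi.eq_or_lt
    · exact hK
    · obtain ⟨i, rfl⟩ := Nat.exists_eq_add_of_le' hi
      exact h.extZero_left₃ (hL.extZero (by lia)) (hM.extZero (by lia))
  · refine (injective_iff_map_eq_zero _).2 fun k hk => ?_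
    obtain ⟨m, rfl⟩ := h.2.2 k
    obtain ⟨φ, hφ⟩ := hT.exists_lift_of_comp_eq_zero (muC R S C M m).toLin fun c =>
      congrArg (fun ψ : HomC R S C (BTensor R S C K) => ψ.toLin c) hk
    obtain ⟨l, hl⟩ := hL.3.2 (HomC.ofLin φ)
    have h1 : muC R S C M (f l) = muC R S C M m := by
      rw [← muC_naturality, hl]
      exact hφ
    rw [← hM.3.1 h1, h.2.1.apply_apply_eq_zero]
  · obtain ⟨ψ, hψ⟩ := hT.exists_lift (hL.2 1 le_rfl) φ.toLin
    obtain ⟨m, hm⟩ := hM.3.2 (HomC.ofLin ψ)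
    refine ⟨g m, ?_⟩
    rw [← muC_naturality, hm]
    exact hψ

/-- The Auslander class is closed under kernels of epimorphisms. -/
lemma inAuslander₁ (h : IsShortExact f g) (hM : InAuslander R S C M) (hK : InAuslander R S C K) :
    InAuslander R S C L := by
  have hT := BTensor.isShortExact h (h.tensor_injective (R := R) (hK.extZero le_rfl))
  rw [inAuslander_iff]
  refine ⟨fun i hi => h.extZero_left₁ (hM.extZero hi) (hK.extZero (by lia)), fun i hi => ?_, ?_,
    fun φ => ?_⟩
  · obtain rfl | hi := hi.eq_or_lt
    -- A map C → C ⊗ K is μ_K k for some k; a preimage m of k supplies the lift μ_M m.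
    · refine hT.extZero_one_right (hM.2 1 le_rfl) fun φ => ?_
      obtain ⟨k, hk⟩ := hK.3.2 (HomC.ofLin φ)
      obtain ⟨m, rfl⟩ := h.2.2 k
      exact ⟨(muC R S C M m).toLin, hk⟩
    · obtain ⟨i, rfl⟩ := Nat.exists_eq_add_of_le' hi
      exact hT.extZero_right₁ (hM.2 _ (by lia)) (hK.2 _ (by lia))
  · refine fun l l' hl => h.1 (hM.3.1 ?_)
    rw [← muC_naturality, ← muC_naturality, hl]
  · obtain ⟨m, hm⟩ := hM.3.2 (HomC.map (BTensor.map R S C f) φ)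
    have h1 : muC R S C K (g m) = 0 := by
      rw [← muC_naturality, hm]
      exact HomC.ext fun c => hT.2.1.apply_apply_eq_zero (φ.toLin c)
    obtain ⟨l, rfl⟩ := (h.2.1 m).1 ((map_eq_zero_iff _ hK.3.1).1 h1)
    refine ⟨l, HomC.ext fun c => hT.1 ?_⟩
    exact congrArg (fun ψ : HomC R S C (BTensor R S C M) => ψ.toLin c) hm

end IsShortExact

lemma exists_projective_cover {A : Type u} [Ring A] (N : ModuleCat.{u} A) :
    ∃ (P : ModuleCat.{u} A) (p : P →ₗ[A] N), Module.Projective A P ∧ Function.Surjective p :=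
  ⟨ModuleCat.of A (N →₀ A), Finsupp.linearCombination A id,
    inferInstanceAs (Module.Projective A (N →₀ A)), Finsupp.linearCombination_id_surjective A N⟩

/-- By adjunction Hom_S(-, Hom_R(C, I)) is Hom_R(C ⊗ -, I), and vanishing of Tor_1(C, Z) keeps the
kernel inclusion of a projective cover injective after tensoring. -/
lemma IsCInjective.extZero {Z U : ModuleCat.{u} S} (hU : IsCInjective R S C U)
    (hZ : ExtZero Z (ModuleCat.of S (CharDual S C)) 1) : ExtZero Z U 1 := by
  obtain ⟨I, hI, ⟨e⟩⟩ := hU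
  obtain ⟨P, p, hP, hp⟩ := exists_projective_cover Z
  have hs := isShortExact_ker p hp
  refine extZero_congr_right (Y := ModuleCat.of S (HomC R S C I)) e
    (hs.extZero_one_left (extZero_of_projective le_rfl) fun φ => ?_)
  obtain ⟨t, ht⟩ := exists_extend_of_injective (BTensor.map R S C (LinearMap.ker p).subtype)
    (hs.tensor_injective hZ) (homAdjSymm φ)
  exact ⟨homAdj t, LinearMap.ext fun x => HomC.ext fun c =>
    LinearMap.congr_fun ht (btmul R S C c x)⟩

/-- Every module in the Auslander class embeds into a `C`-injective module with cokernel in the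
Auslander class. -/
lemma InAuslander.exists_embedding (hC : IsSemidualizing R S C) {N : ModuleCat.{u} S}
    (hN : InAuslander R S C N) : ∃ (U : ModuleCat.{u} S) (f : N →ₗ[S] U), IsCInjective R S C U ∧
      Function.Injective f ∧ InAuslander R S C (ModuleCat.of S (U ⧸ LinearMap.range f)) := by
  let J := Injective.under (ModuleCat.of R (BTensor R S C N))
  let j : BTensor R S C N →ₗ[R] J := (Injective.ι (ModuleCat.of R (BTensor R S C N))).hom
  have hj : Function.Injective j := (ModuleCat.mono_iff_injective _).1 inferInstance
  let f : N →ₗ[S] HomC R S C J := homAdj j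
  have hf : Function.Injective f := fun x y h => hN.3.1 (HomC.ext fun c => hj
    (congrArg (fun φ : HomC R S C J => φ.toLin c) h))
  have hU := inAuslander_homC (I := J) hC
  have hTf : Function.Injective (BTensor.map R S C f) := by
    -- As the adjoint of f is the injective map j, the map C ⊗ f is injective, which forces Tor_1 of
    -- the cokernel of f to vanish.
    have : evalC R S C J ∘ₗ BTensor.map R S C f = j := BTensor.hom_ext fun _ _ => rfl
    refine Function.Injective.of_comp (f := evalC R S C J) ?_
    rw [← LinearMap.coe_comp, this]
    exact hj
  have hs := isShortExact_mkQ (M := ModuleCat.of S (HomC R S C J)) f hf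
  exact ⟨ModuleCat.of S (HomC R S C J), f, ⟨J, inferInstance, ⟨LinearEquiv.refl S _⟩⟩, hf,
    hs.inAuslander₃ hN hU (hs.extZero_one_left (hU.extZero le_rfl)
      (BTensor.exists_extend_of_map_injective f hTf))⟩

end Closure

/-! ### Relative dimension by recursion on kernels -/

section ResolutionDimension

variable {S : Type u} [Ring S] {𝒳 𝒴 : ModuleCat.{u} S → Prop}

/-- `N` has an `𝒳`-resolution of length `n`, defined by recursion on `n`. -/
def ResDim (𝒳 : ModuleCat.{u} S → Prop) : ℕ → ModuleCat.{u} S → Prop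
  | 0, N => 𝒳 N
  | n + 1, N => ∃ (X : ModuleCat.{u} S) (p : X →ₗ[S] N), 𝒳 X ∧ Function.Surjective p ∧
      ResDim 𝒳 n (ModuleCat.of S (LinearMap.ker p))

/-- The class `𝒳` is closed under isomorphism. -/
def IsoClosed (𝒳 : ModuleCat.{u} S → Prop) : Prop :=
  ∀ ⦃X Y : ModuleCat.{u} S⦄, (X ≃ₗ[S] Y) → 𝒳 Y → 𝒳 X

lemma ResDim.mono (h : ∀ X, 𝒳 X → 𝒴 X) {n : ℕ} {N : ModuleCat.{u} S} (hN : ResDim 𝒳 n N) :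
    ResDim 𝒴 n N := by
  induction n generalizing N with
  | zero => exact h N hN
  | succ n ih =>
    obtain ⟨X, p, hX, hp, hK⟩ := hN
    exact ⟨X, p, h X hX, hp, ih hK⟩

lemma ResDim.of_equiv (h𝒳 : IsoClosed 𝒳) {n : ℕ} {N N' : ModuleCat.{u} S} (e : N ≃ₗ[S] N')
    (hN : ResDim 𝒳 n N') : ResDim 𝒳 n N := by
  cases n with
  | zero => exact h𝒳 e hN
  | succ n =>
    obtain ⟨X, p, hX, hp, hK⟩ := hN
    refine ⟨X, e.symm.toLinearMap ∘ₗ p, hX, e.symm.surjective.comp hp, ?_⟩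
    rw [LinearEquiv.ker_comp]
    exact hK

/-- The first term of a short exact sequence is the kernel of the second map. -/
noncomputable def IsShortExact.kerEquiv {L M K : ModuleCat.{u} S} {f : L →ₗ[S] M} {g : M →ₗ[S] K}
    (h : IsShortExact f g) : LinearMap.ker g ≃ₗ[S] L :=
  (LinearEquiv.ofEq _ _ h.2.1.linearMap_ker_eq).trans (LinearEquiv.ofInjective f h.1).symm

lemma ResDim.of_isShortExact (h𝒳 : IsoClosed 𝒳) {n : ℕ} {L M K : ModuleCat.{u} S}
    {f : L →ₗ[S] M} {g : M →ₗ[S] K} (h : IsShortExact f g) (hM : 𝒳 M) (hL : ResDim 𝒳 n L) :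
    ResDim 𝒳 (n + 1) K :=
  ⟨M, g, hM, h.2.2, hL.of_equiv (N := ModuleCat.of S (LinearMap.ker g)) h𝒳 h.kerEquiv⟩

lemma ResDim.succ (h0 : ∀ Z : ModuleCat.{u} S, Subsingleton Z → 𝒳 Z) {n : ℕ}
    {N : ModuleCat.{u} S} (hN : ResDim 𝒳 n N) : ResDim 𝒳 (n + 1) N := by
  induction n generalizing N with
  | zero =>
    refine ⟨N, LinearMap.id, hN, Function.surjective_id, h0 _ ?_⟩
    exact ⟨fun x y => Subtype.ext (x.2.trans y.2.symm)⟩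
  | succ n ih =>
    obtain ⟨X, p, hX, hp, hK⟩ := hN
    exact ⟨X, p, hX, hp, ih hK⟩

lemma ResDim.of_le (h0 : ∀ Z : ModuleCat.{u} S, Subsingleton Z → 𝒳 Z)
    {m n : ℕ} (hmn : m ≤ n) {N : ModuleCat.{u} S} (hN : ResDim 𝒳 m N) : ResDim 𝒳 n N := by
  induction n, hmn using Nat.le_induction with
  | base => exact hN
  | succ n _ ih => exact ih.succ h0

lemma HasResolutionOfLength.resDim (h𝒳 : IsoClosed 𝒳) {n : ℕ} {N : ModuleCat.{u} S}
    (h : HasResolutionOfLength 𝒳 N n) : ResDim 𝒳 n N := by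
  induction n generalizing N with
  | zero =>
    obtain ⟨X, d, ε, hX, h0, hε, hd0, -⟩ := h
    have := h0 1 one_pos
    refine h𝒳 (LinearEquiv.ofBijective ε ⟨?_, hε⟩).symm (hX 0 le_rfl)
    refine (injective_iff_map_eq_zero ε).2 fun x hx => ?_
    obtain ⟨y, rfl⟩ := (hd0 x).1 hx
    rw [Subsingleton.elim y 0, map_zero]
  | succ n ih =>
    obtain ⟨X, d, ε, hX, h0, hε, hd0, hd⟩ := h
    refine ⟨X 0, ε, hX 0 (Nat.zero_le _), hε, ih ⟨fun i => X (i + 1), fun i => d (i + 1),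
      (d 0).codRestrict (LinearMap.ker ε) fun x => hd0.apply_apply_eq_zero x,
      fun i hi => hX _ (by lia), fun i hi => h0 _ (by lia), ?_, fun x => ?_, fun i => hd _⟩⟩
    · rintro ⟨y, hy⟩
      obtain ⟨x, rfl⟩ := (hd0 y).1 hy
      exact ⟨x, rfl⟩
    · rw [← hd 0 x]
      exact Subtype.ext_iff

lemma ResDim.hasResolutionOfLength {n : ℕ} {N : ModuleCat.{u} S} (h : ResDim 𝒳 n N) :
    HasResolutionOfLength 𝒳 N n := by
  induction n generalizing N with
  | zero =>
    refine ⟨fun i => Nat.casesOn i N fun _ => ModuleCat.of S PUnit, fun i => 0, LinearMap.id,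
      fun i hi => ?_, fun i hi => ?_, Function.surjective_id, fun x => ?_, fun i x => ?_⟩
    · obtain rfl : i = 0 := Nat.le_zero.1 hi
      exact h
    · obtain ⟨i, rfl⟩ := Nat.exists_eq_add_of_lt hi
      rw [zero_add]
      exact inferInstanceAs (Subsingleton PUnit)
    · exact ⟨fun hx => ⟨0, hx.symm⟩, fun ⟨_, hy⟩ => hy.symm⟩
    · exact ⟨fun _ => ⟨0, Subsingleton.elim (α := PUnit) _ _⟩, fun _ => rfl⟩
  | succ n ih =>
    obtain ⟨Y, p, hY, hp, hK⟩ := h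
    obtain ⟨X, d, ε, hX, h0, hε, hd0, hd⟩ := ih hK
    refine ⟨fun i => Nat.casesOn i Y X, fun i => match i with
      | 0 => (LinearMap.ker p).subtype ∘ₗ ε
      | i + 1 => d i, p, fun i hi => ?_, fun i hi => ?_, hp, fun x => ?_, fun i => ?_⟩
    · cases i with
      | zero => exact hY
      | succ i => exact hX i (by lia)
    · cases i with
      | zero => exact absurd hi (Nat.not_lt_zero _)
      | succ i => exact h0 i (by lia)
    · constructor
      · intro hx
        obtain ⟨y, hy⟩ := hε ⟨x, hx⟩
        exact ⟨y, congrArg Subtype.val hy⟩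
      · rintro ⟨y, rfl⟩
        exact (ε y).2
    · cases i with
      | zero =>
        intro x
        refine Iff.trans ?_ (hd0 x)
        exact (Submodule.coe_eq_zero (x := ε x))
      | succ i => exact hd i

lemma relPd_le_iff (h𝒳 : IsoClosed 𝒳) (h0 : ∀ Z : ModuleCat.{u} S, Subsingleton Z → 𝒳 Z)
    {N : ModuleCat.{u} S} {n : ℕ} : relPd 𝒳 N ≤ n ↔ ResDim 𝒳 n N := by
  refine ⟨fun h => ?_, fun h => iInf₂_le n h.hasResolutionOfLength⟩
  by_contra hn
  -- A shorter resolution can be padded with zero modules, so failure at n excludes every length m ≤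
  -- n.
  have : ((n + 1 : ℕ) : ℕ∞) ≤ relPd 𝒳 N := le_iInf₂ fun m hm => by
    by_contra hlt
    have hmn : m ≤ n := by
      rw [Nat.cast_le] at hlt
      lia
    exact hn ((hm.resDim h𝒳).of_le h0 hmn)
  have h2 := this.trans h
  rw [Nat.cast_le] at h2
  lia

lemma exists_resDim_of_relPd_lt_top (h𝒳 : IsoClosed 𝒳) {N : ModuleCat.{u} S}
    (h : relPd 𝒳 N < ⊤) : ∃ m, ResDim 𝒳 m N := by
  by_contra! hne
  refine h.ne (iInf₂_eq_top.2 fun m hm => absurd (hm.resDim h𝒳) (hne m))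

end ResolutionDimension

/-! ### Dimension shifting and syzygies -/

section Syzygy

lemma exists_isSyzygy {S : Type u} [Ring S] (n : ℕ) (N : ModuleCat.{u} S) :
    ∃ K, IsSyzygy n N K := by
  induction n generalizing N with
  | zero => exact ⟨N, ⟨LinearEquiv.refl S N⟩⟩
  | succ n ih =>
    obtain ⟨P, p, hP, hp⟩ := exists_projective_cover N
    obtain ⟨K, hK⟩ := ih (ModuleCat.of S (LinearMap.ker p))
    exact ⟨K, P, p, hP, hp, hK⟩

variable {R S C : Type u} [Ring R] [Ring S] [AddCommGroup C] [Module R C] [Module Sᵐᵒᵖ C]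
  [SMulCommClass R Sᵐᵒᵖ C]

lemma isoClosed_inAuslander : IsoClosed (InAuslander R S C) := fun _ _ e h => h.of_equiv e

lemma isoClosed_isCInjective : IsoClosed (IsCInjective R S C) := fun _ _ e ⟨I, hI, ⟨e'⟩⟩ =>
  ⟨I, hI, ⟨e.trans e'⟩⟩

lemma isCInjective_of_subsingleton (Z : ModuleCat.{u} S) (hZ : Subsingleton Z) :
    IsCInjective R S C Z := by
  have hs : Subsingleton (HomC R S C PUnit.{u + 1}) :=
    ⟨fun f g => HomC.ext fun c => Subsingleton.elim (f.toLin c) (g.toLin c)⟩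
  exact ⟨ModuleCat.of R PUnit, (ModuleCat.isZero_of_subsingleton _).injective,
    ⟨{ (0 : Z →ₗ[S] HomC R S C PUnit.{u + 1}) with
      invFun := fun _ => 0
      left_inv := fun _ => Subsingleton.elim _ _
      right_inv := fun _ => hs.elim _ _ }⟩⟩

lemma ResDim.extZero {n : ℕ} {N : ModuleCat.{u} S} (hN : ResDim (InAuslander R S C) n N) {i : ℕ}
    (hi : n + 1 ≤ i) : ExtZero N (ModuleCat.of S (CharDual S C)) i := by
  induction n generalizing N i with
  | zero => exact InAuslander.extZero hN hi
  | succ n ih =>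
    obtain ⟨X, p, hX, hp, hK⟩ := hN
    obtain ⟨i, rfl⟩ := Nat.exists_eq_add_of_le' (show 1 ≤ i by lia)
    exact (isShortExact_ker p hp).extZero_left₃ (ih hK (by lia)) (hX.extZero (by lia))

/-- A module of finite Auslander dimension with vanishing `Tor` is in the Auslander class. -/
lemma ResDim.inAuslander {m : ℕ} {N : ModuleCat.{u} S} (hN : ResDim (InAuslander R S C) m N)
    (h : ∀ i, 1 ≤ i → ExtZero N (ModuleCat.of S (CharDual S C)) i) : InAuslander R S C N := by
  induction m generalizing N with
  | zero => exact hN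
  | succ m ih =>
    obtain ⟨X, p, hX, hp, hK⟩ := hN
    have hs := isShortExact_ker p hp
    exact hs.inAuslander₃ (ih hK fun i hi => hs.extZero_left₁ (hX.extZero hi) (h _ (by lia))) hX
      (h 1 le_rfl)

/-- Take a cover p : A → E. The preimage of L in A is the kernel of A → X, so it lies in the class,
and it maps onto L with the same kernel as p. -/
lemma ResDim.of_isShortExact_left {m : ℕ} {L E X : ModuleCat.{u} S} {f : L →ₗ[S] E}
    {g : E →ₗ[S] X} (h : IsShortExact f g) (hE : ResDim (InAuslander R S C) m E)
    (hX : InAuslander R S C X) : ResDim (InAuslander R S C) m L := by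
  cases m with
  | zero => exact h.inAuslander₁ hE hX
  | succ m =>
    obtain ⟨A, p, hA, hp, hK⟩ := hE
    have hs := isShortExact_ker (X := X) (g ∘ₗ p) (h.2.2.comp hp)
    have hA' : InAuslander R S C (ModuleCat.of S (LinearMap.ker (g ∘ₗ p))) :=
      hs.inAuslander₁ hA hX
    obtain ⟨q, hq⟩ := h.exists_lift_of_comp_eq_zero (p ∘ₗ (LinearMap.ker (g ∘ₗ p)).subtype)
      fun x => x.2
    have hq' : ∀ x, f (q x) = p x.1 := fun x => LinearMap.congr_fun hq x
    have hse : IsShortExact (L := ModuleCat.of S (LinearMap.ker p))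
        (M := ModuleCat.of S (LinearMap.ker (g ∘ₗ p)))
        (Submodule.inclusion (LinearMap.ker_le_ker_comp p g)) q := by
      refine ⟨Submodule.inclusion_injective _, fun x => ⟨fun hx => ?_, ?_⟩, fun l => ?_⟩
      · refine ⟨⟨x.1, ?_⟩, rfl⟩
        rw [LinearMap.mem_ker, ← hq', hx, map_zero]
      · rintro ⟨y, rfl⟩
        exact h.1 ((hq' _).trans (y.2.trans (map_zero f).symm))
      · obtain ⟨a, ha⟩ := hp (f l)
        refine ⟨⟨a, ?_⟩, h.1 ((hq' _).trans ha)⟩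
        rw [LinearMap.mem_ker, LinearMap.comp_apply, ha, h.2.1.apply_apply_eq_zero]
    exact ResDim.of_isShortExact isoClosed_inAuslander hse hA' hK

lemma isShortExact_prod (S : Type u) [Ring S] (X Y : ModuleCat.{u} S) :
    IsShortExact (M := ModuleCat.of S (X × Y)) (LinearMap.inl S X Y) (LinearMap.snd S X Y) :=
  ⟨LinearMap.inl_injective, Function.Exact.inl_snd, Prod.snd_surjective⟩

lemma ResDim.prod {m : ℕ} {K P : ModuleCat.{u} S} (hK : ResDim (InAuslander R S C) m K)
    (hP : InAuslander R S C P) :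
    ResDim (InAuslander R S C) m (ModuleCat.of S (K × P)) := by
  cases m with
  | zero => exact (isShortExact_prod S K P).inAuslander₂ hK hP
  | succ m =>
    obtain ⟨X, p, hX, hp, hK⟩ := hK
    refine ResDim.of_isShortExact (L := ModuleCat.of S (LinearMap.ker p))
      (M := ModuleCat.of S (X × P))
      (f := LinearMap.inl S X P ∘ₗ (LinearMap.ker p).subtype)
      (g := p.prodMap LinearMap.id) isoClosed_inAuslander ?_
      ((isShortExact_prod S X P).inAuslander₂ hX hP) hK
    refine ⟨LinearMap.inl_injective.comp Subtype.val_injective, fun x => ⟨fun hx => ?_, ?_⟩,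
      hp.prodMap Function.surjective_id⟩
    · obtain ⟨a, b⟩ := x
      obtain ⟨ha, hb⟩ := Prod.ext_iff.1 hx
      exact ⟨⟨a, ha⟩, Prod.ext rfl hb.symm⟩
    · rintro ⟨y, rfl⟩
      exact Prod.ext y.2 rfl

variable (hC : IsSemidualizing R S C)
include hC

lemma inAuslander_of_subsingleton (Z : ModuleCat.{u} S) (hZ : Subsingleton Z) :
    InAuslander R S C Z := (isCInjective_of_subsingleton Z hZ).inAuslander hC

/-- A syzygy of a module of finite Auslander dimension has finite Auslander dimension. -/
lemma exists_resDim_ker {N P : ModuleCat.{u} S} (hN : ∃ m, ResDim (InAuslander R S C) m N)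
    [Module.Projective S P] (p : P →ₗ[S] N) (hp : Function.Surjective p) :
    ∃ m, ResDim (InAuslander R S C) m (ModuleCat.of S (LinearMap.ker p)) := by
  have hP := inAuslander_of_projective hC P
  obtain ⟨_ | m, hN⟩ := hN
  · exact ⟨0, (isShortExact_ker p hp).inAuslander₁ hP hN⟩
  · obtain ⟨X, q, hX, hq, hK⟩ := hN
    -- Lifting p through the cover q gives 0 → ker p → ker q × P → X → 0, with maps y ↦ (-φ y, y)
    -- and (k, y) ↦ k + φ y.
    obtain ⟨φ, hφ⟩ := Module.projective_lifting_property q p hq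
    have hφ' : ∀ y, q (φ y) = p y := fun y => LinearMap.congr_fun hφ y
    refine ⟨m, ResDim.of_isShortExact_left (E := ModuleCat.of S (LinearMap.ker q × P)) (X := X)
      (f := LinearMap.prod ((-φ ∘ₗ (LinearMap.ker p).subtype).codRestrict (LinearMap.ker q)
        fun y => ?_) (LinearMap.ker p).subtype)
      (g := (LinearMap.ker q).subtype.coprod φ) ?_ (hK.prod hP) hX⟩
    · change q (-φ y.1) = 0
      rw [map_neg, hφ', y.2, neg_zero]
    · refine ⟨fun x y h => Subtype.ext (congrArg Prod.snd h), fun x => ⟨fun hx => ?_, ?_⟩,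
        fun x => ?_⟩
      · obtain ⟨k, y⟩ := x
        have h1 : k.1 + φ y = 0 := hx
        refine ⟨⟨y, ?_⟩, Prod.ext (Subtype.ext (eq_neg_of_add_eq_zero_left h1).symm) rfl⟩
        have h2 := congrArg q h1
        rwa [map_add, hφ', LinearMap.mem_ker.1 k.2, zero_add, map_zero] at h2
      · rintro ⟨y, rfl⟩
        exact neg_add_cancel (φ y.1)
      · obtain ⟨y, hy⟩ := hp (q x)
        refine ⟨(⟨x - φ y, ?_⟩, y), sub_add_cancel x (φ y)⟩
        rw [LinearMap.mem_ker, map_sub, hφ', hy, sub_self]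

lemma IsSyzygy.inAuslander {n : ℕ} {N K : ModuleCat.{u} S} (hK : IsSyzygy n N K)
    (hN : ∃ m, ResDim (InAuslander R S C) m N)
    (h : ∀ i, n + 1 ≤ i → ExtZero N (ModuleCat.of S (CharDual S C)) i) :
    InAuslander R S C K := by
  induction n generalizing N with
  | zero =>
    obtain ⟨e⟩ := hK
    obtain ⟨m, hN⟩ := hN
    exact (hN.inAuslander fun i hi => h i (by lia)).of_equiv e
  | succ n ih =>
    obtain ⟨P, p, hP, hp, hK⟩ := hK
    exact ih hK (exists_resDim_ker hC hN p hp) fun i hi =>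
      (isShortExact_ker p hp).extZero_left₁ (extZero_of_projective (by lia)) (h _ (by lia))

lemma IsSyzygy.resDim {n : ℕ} {N K : ModuleCat.{u} S} (hK : IsSyzygy n N K)
    (h : InAuslander R S C K) : ResDim (InAuslander R S C) n N := by
  induction n generalizing N with
  | zero =>
    obtain ⟨e⟩ := hK
    exact h.of_equiv e.symm
  | succ n ih =>
    obtain ⟨P, p, hP, hp, hK⟩ := hK
    exact ⟨P, p, inAuslander_of_projective hC P, hp, ih hK⟩

end Syzygy

/-! ### Auslander–Buchweitz approximations -/

section Approximation

/-- Quotients of a module `M` by submodules `p ≤ q` give `0 → q/p → M/p → M/q → 0`. -/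
lemma isShortExact_quotient {S : Type u} [Ring S] {L M K Q : ModuleCat.{u} S} {f : L →ₗ[S] M}
    {g : M →ₗ[S] K} (h : IsShortExact f g) (u : M →ₗ[S] Q) (hu : Function.Injective u) :
    ∃ v : K →ₗ[S] (Q ⧸ LinearMap.range (u ∘ₗ f)),
      v ∘ₗ g = (LinearMap.range (u ∘ₗ f)).mkQ ∘ₗ u ∧
      IsShortExact (M := ModuleCat.of S (Q ⧸ LinearMap.range (u ∘ₗ f)))
        (K := ModuleCat.of S (Q ⧸ LinearMap.range u)) v
        (Submodule.factor (LinearMap.range_comp_le_range f u)) := by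
  obtain ⟨v, hv⟩ := exists_factor_of_surjective g h.2.2 ((LinearMap.range (u ∘ₗ f)).mkQ ∘ₗ u) (by
    intro m hm
    obtain ⟨l, rfl⟩ := (h.2.1 m).1 hm
    exact (Submodule.Quotient.mk_eq_zero _).2 ⟨l, rfl⟩)
  have hv' : ∀ m, v (g m) = (LinearMap.range (u ∘ₗ f)).mkQ (u m) :=
    fun m => LinearMap.congr_fun hv m
  refine ⟨v, hv, ?_, fun x => ?_, Submodule.factor_surjective _⟩
  · refine (injective_iff_map_eq_zero v).2 fun k hk => ?_
    obtain ⟨m, rfl⟩ := h.2.2 k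
    rw [hv'] at hk
    obtain ⟨l, hl⟩ := (Submodule.Quotient.mk_eq_zero _).1 hk
    rw [← hu hl, h.2.1.apply_apply_eq_zero]
  · obtain ⟨x, rfl⟩ := Submodule.mkQ_surjective _ x
    refine (Submodule.Quotient.mk_eq_zero _).trans ⟨?_, ?_⟩
    · rintro ⟨m, rfl⟩
      exact ⟨g m, hv' m⟩
    · rintro ⟨k, hk⟩
      obtain ⟨m, rfl⟩ := h.2.2 k
      rw [hv'] at hk
      obtain ⟨l, hl⟩ := (Submodule.Quotient.eq _).1 hk
      refine ⟨m - f l, ?_⟩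
      rw [map_sub]
      have : u (f l) = u m - x := hl
      rw [this, sub_sub_cancel]
      rfl

/-- The pushout of a short exact sequence along a short exact sequence. -/
lemma exists_pushout {S : Type u} [Ring S] {K X N H B : ModuleCat.{u} S} {i : K →ₗ[S] X}
    {p : X →ₗ[S] N} {a : K →ₗ[S] H} {b : H →ₗ[S] B} (h : IsShortExact i p)
    (h' : IsShortExact a b) : ∃ (E : ModuleCat.{u} S) (f : H →ₗ[S] E) (g : E →ₗ[S] N)
      (f' : X →ₗ[S] E) (g' : E →ₗ[S] B), IsShortExact f g ∧ IsShortExact f' g' := by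
  -- The pushout is the cokernel of (i, -a); the sign makes the two images of K agree.
  let d : K →ₗ[S] X × H := LinearMap.prod i (-a)
  let π := (LinearMap.range d).mkQ
  have hπ : ∀ x y, π (x, y) = 0 ↔ ∃ k, i k = x ∧ -a k = y := fun x y =>
    (Submodule.Quotient.mk_eq_zero _).trans
      ⟨fun ⟨k, hk⟩ => ⟨k, (Prod.ext_iff.1 hk).1, (Prod.ext_iff.1 hk).2⟩,
        fun ⟨k, h1, h2⟩ => ⟨k, Prod.ext h1 h2⟩⟩
  let g : (X × H) ⧸ LinearMap.range d →ₗ[S] N :=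
    (LinearMap.range d).liftQ (p ∘ₗ LinearMap.fst S X H) (by
      rintro _ ⟨k, rfl⟩
      exact h.2.1.apply_apply_eq_zero k)
  let g' : (X × H) ⧸ LinearMap.range d →ₗ[S] B :=
    (LinearMap.range d).liftQ (b ∘ₗ LinearMap.snd S X H) (by
      rintro _ ⟨k, rfl⟩
      change b (-a k) = 0
      rw [map_neg, h'.2.1.apply_apply_eq_zero, neg_zero])
  refine ⟨ModuleCat.of S ((X × H) ⧸ LinearMap.range d), π ∘ₗ LinearMap.inr S X H, g,
    π ∘ₗ LinearMap.inl S X H, g', ⟨?_, fun e => ?_, fun n => ?_⟩, ⟨?_, fun e => ?_, fun n => ?_⟩⟩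
  · refine (injective_iff_map_eq_zero _).2 fun y hy => ?_
    obtain ⟨k, h1, h2⟩ := (hπ 0 y).1 hy
    rw [← h2, (map_eq_zero_iff i h.1).1 h1, map_zero, neg_zero]
  · obtain ⟨⟨x, y⟩, rfl⟩ := Submodule.mkQ_surjective _ e
    constructor
    · intro hx
      obtain ⟨k, rfl⟩ := (h.2.1 x).1 hx
      refine ⟨y + a k, sub_eq_zero.1 ?_⟩
      change π (0, y + a k) - π (i k, y) = 0
      rw [← map_sub, Prod.mk_sub_mk, hπ]
      exact ⟨-k, by rw [map_neg, zero_sub], by rw [map_neg, neg_neg, add_sub_cancel_left]⟩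
    · rintro ⟨z, hz⟩
      rw [← hz]
      exact map_zero p
  · obtain ⟨x, rfl⟩ := h.2.2 n
    exact ⟨π (x, 0), rfl⟩
  · refine (injective_iff_map_eq_zero _).2 fun x hx => ?_
    obtain ⟨k, h1, h2⟩ := (hπ x 0).1 hx
    rw [← h1, (map_eq_zero_iff a h'.1).1 (neg_eq_zero.1 h2), map_zero]
  · obtain ⟨⟨x, y⟩, rfl⟩ := Submodule.mkQ_surjective _ e
    constructor
    · intro hy
      obtain ⟨k, rfl⟩ := (h'.2.1 y).1 hy
      refine ⟨x + i k, sub_eq_zero.1 ?_⟩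
      change π (x + i k, 0) - π (x, a k) = 0
      rw [← map_sub, Prod.mk_sub_mk, hπ]
      exact ⟨k, by rw [add_sub_cancel_left], by rw [zero_sub]⟩
    · rintro ⟨z, hz⟩
      rw [← hz]
      exact map_zero b
  · obtain ⟨y, rfl⟩ := h'.2.2 n
    exact ⟨π (0, y), rfl⟩

variable {R S C : Type u} [Ring R] [Ring S] [AddCommGroup C] [Module R C] [Module Sᵐᵒᵖ C]
  [SMulCommClass R Sᵐᵒᵖ C] (hC : IsSemidualizing R S C)
include hC

/-- Embed A into a C-injective U with cokernel in the class. Then N = A/H embeds into H' = U/H with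
cokernel U/A, and 0 → H → U → H' → 0 raises the dimension by one. -/
lemma exists_hull_of_cover {n : ℕ} {H A N : ModuleCat.{u} S} {f : H →ₗ[S] A} {g : A →ₗ[S] N}
    (h : IsShortExact f g) (hA : InAuslander R S C A) (hH : ResDim (IsCInjective R S C) n H) :
    ∃ (H' A' : ModuleCat.{u} S) (f : N →ₗ[S] H') (g : H' →ₗ[S] A'), IsShortExact f g ∧
      InAuslander R S C A' ∧ ResDim (IsCInjective R S C) (n + 1) H' := by
  obtain ⟨U, u, hU, hu, hQ⟩ := hA.exists_embedding hC
  obtain ⟨v, -, hv⟩ := isShortExact_quotient h u hu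
  exact ⟨_, _, v, _, hv, hQ, ResDim.of_isShortExact isoClosed_isCInjective
    (isShortExact_mkQ (u ∘ₗ f) (hu.comp h.1)) hU hH⟩

/-- Pushing out 0 → ker p → X → N → 0 along a hull of ker p gives a cover 0 → H → E → N → 0. Here E
is an extension of modules in the class, and `exists_hull_of_cover` converts the cover into a hull.
-/
lemma ResDim.exists_hull {n : ℕ} {N : ModuleCat.{u} S} (hN : ResDim (InAuslander R S C) n N) :
    ∃ (H' A' : ModuleCat.{u} S) (f : N →ₗ[S] H') (g : H' →ₗ[S] A'), IsShortExact f g ∧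
      InAuslander R S C A' ∧ ResDim (IsCInjective R S C) n H' := by
  induction n generalizing N with
  | zero =>
    obtain ⟨U, u, hU, hu, hQ⟩ := InAuslander.exists_embedding hC hN
    exact ⟨U, _, u, _, isShortExact_mkQ u hu, hQ, hU⟩
  | succ n ih =>
    obtain ⟨X, p, hX, hp, hK⟩ := hN
    obtain ⟨H, B, a, b, hab, hB, hH⟩ := ih hK
    obtain ⟨E, f, g, f', g', h1, h2⟩ := exists_pushout (isShortExact_ker p hp) hab
    exact exists_hull_of_cover hC h1 (h2.inAuslander₂ hX hB) hH

lemma ResDim.exists_cover {n : ℕ} {N : ModuleCat.{u} S}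
    (hN : ResDim (InAuslander R S C) (n + 1) N) :
    ∃ (H A : ModuleCat.{u} S) (f : H →ₗ[S] A) (g : A →ₗ[S] N), IsShortExact f g ∧
      InAuslander R S C A ∧ ResDim (IsCInjective R S C) n H := by
  obtain ⟨X, p, hX, hp, hK⟩ := hN
  obtain ⟨H, B, a, b, hab, hB, hH⟩ := hK.exists_hull hC
  obtain ⟨E, f, g, f', g', h1, h2⟩ := exists_pushout (isShortExact_ker p hp) hab
  exact ⟨H, E, f, g, h1, h2.inAuslander₂ hX hB, hH⟩

omit hC in
lemma IsShortExact.isHomExact {N H A : ModuleCat.{u} S} {f : N →ₗ[S] H} {g : H →ₗ[S] A}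
    (h : IsShortExact f g) (hA : InAuslander R S C A) : IsHomExact (IsCInjective R S C) f g := by
  refine fun U hU => ⟨fun φ ψ hφ => ?_, fun φ => ⟨fun hφ => ?_, ?_⟩,
    fun φ => h.exists_extend (hU.extZero (hA.extZero le_rfl)) φ⟩
  · exact (LinearMap.cancel_right h.2.2).1 hφ
  · refine exists_factor_of_surjective g h.2.2 φ fun m hm => ?_
    obtain ⟨l, rfl⟩ := (h.2.1 m).1 hm
    exact LinearMap.congr_fun hφ l
  · rintro ⟨ψ, rfl⟩
    exact LinearMap.ext fun x => by
      change ψ (g (f x)) = 0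
      rw [h.2.1.apply_apply_eq_zero, map_zero]

end Approximation

end AuslanderClass

/-! ### The equivalences -/

theorem theorem4p4 (R S C : Type u) [Ring R] [Ring S] [AddCommGroup C] [Module R C]
    [Module Sᵐᵒᵖ C] [SMulCommClass R Sᵐᵒᵖ C] (hC : IsSemidualizing R S C)
    (N : ModuleCat.{u} S) (hN : relPd (InAuslander R S C) N < ⊤) (n : ℕ) :
    List.TFAE [
      -- the Auslander projective dimension is at most `n`
      relPd (InAuslander R S C) N ≤ n,
      -- some `n`-th syzygy, respectively every `n`-th syzygy, is in the Auslander class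
      ∃ K : ModuleCat.{u} S, IsSyzygy n N K ∧ InAuslander R S C K,
      ∀ K : ModuleCat.{u} S, IsSyzygy n N K → InAuslander R S C K,
      -- `Tor` vanishes in degrees at least `n + 1`
      ∀ i : ℕ, n + 1 ≤ i → Subsingleton (TorC R S C i N),
      -- `0 → H → A → N → 0` with the dimension of `H` at most `n - 1`, where dimension
      -- at most `-1` means that `H = 0`
      ∃ (H A : ModuleCat.{u} S) (f : H →ₗ[S] A) (g : A →ₗ[S] N), IsShortExact f g ∧
        InAuslander R S C A ∧
        ((n = 0 ∧ Subsingleton H) ∨ relPd (IsCInjective R S C) H + 1 ≤ n),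
      -- `0 → N → H' → A' → 0` exact
      ∃ (H' A' : ModuleCat.{u} S) (f : N →ₗ[S] H') (g : H' →ₗ[S] A'), IsShortExact f g ∧
        InAuslander R S C A' ∧ relPd (IsCInjective R S C) H' ≤ n,
      -- the same, with a sequence that is moreover exact under `Hom(-, C-injective)`
      ∃ (H' A' : ModuleCat.{u} S) (f : N →ₗ[S] H') (g : H' →ₗ[S] A'), IsShortExact f g ∧
        IsHomExact (IsCInjective R S C) f g ∧
        InAuslander R S C A' ∧ relPd (IsCInjective R S C) H' ≤ n] := by
  have hfin := exists_resDim_of_relPd_lt_top isoClosed_inAuslander hN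
  have hA : ∀ {M : ModuleCat.{u} S} {k : ℕ},
      relPd (InAuslander R S C) M ≤ k ↔ ResDim (InAuslander R S C) k M :=
    relPd_le_iff isoClosed_inAuslander (inAuslander_of_subsingleton hC)
  have hI : ∀ {M : ModuleCat.{u} S} {k : ℕ},
      relPd (IsCInjective R S C) M ≤ k ↔ ResDim (IsCInjective R S C) k M :=
    relPd_le_iff isoClosed_isCInjective isCInjective_of_subsingleton
  have hIA : ∀ {M : ModuleCat.{u} S} {k : ℕ}, ResDim (IsCInjective R S C) k M →
      ResDim (InAuslander R S C) k M := ResDim.mono fun X hX => hX.inAuslander hC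
  tfae_have 1 → 4 := fun h i hi =>
    (subsingleton_torC_iff (by lia)).2 ((hA.1 h).extZero hi)
  tfae_have 4 → 3 := fun h K hK =>
    hK.inAuslander hC hfin fun i hi => (subsingleton_torC_iff (by lia)).1 (h i hi)
  tfae_have 3 → 2 := fun h => by
    obtain ⟨K, hK⟩ := exists_isSyzygy n N
    exact ⟨K, hK, h K hK⟩
  tfae_have 2 → 1 := fun ⟨K, hK, h⟩ => hA.2 (hK.resDim hC h)
  tfae_have 1 → 5 := fun h => by
    rw [hA] at h
    cases n with
    | zero =>
      refine ⟨ModuleCat.of S PUnit, N, 0, LinearMap.id, ⟨fun _ _ _ => Subsingleton.elim _ _,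
        fun x => ⟨fun hx => ⟨0, hx.symm⟩, fun ⟨_, hy⟩ => hy.symm⟩, Function.surjective_id⟩, h,
        Or.inl ⟨rfl, inferInstanceAs (Subsingleton PUnit)⟩⟩
    | succ n =>
      obtain ⟨H, A, f, g, hs, hA', hH⟩ := h.exists_cover hC
      refine ⟨H, A, f, g, hs, hA', Or.inr ?_⟩
      rw [Nat.cast_succ]
      exact add_le_add_left (hI.2 hH) 1
  tfae_have 5 → 1 := fun ⟨H, A, f, g, hs, hA', h⟩ => by
    rw [hA]
    obtain ⟨rfl, hH⟩ | h := h
    · have hf : Function.Injective g := (injective_iff_map_eq_zero g).2 fun x hx => by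
        obtain ⟨y, rfl⟩ := (hs.2.1 x).1 hx
        rw [Subsingleton.elim y 0, map_zero]
      exact hA'.of_equiv (LinearEquiv.ofBijective g ⟨hf, hs.2.2⟩).symm
    · cases n with
      -- A dimension plus one is never at most 0, so for n = 0 only the alternative H = 0 is
      -- possible.
      | zero => simp at h
      | succ n =>
        rw [Nat.cast_succ, ENat.add_le_add_iff_right ENat.one_ne_top, hI] at h
        exact ResDim.of_isShortExact isoClosed_inAuslander hs hA' (hIA h)
  tfae_have 1 → 7 := fun h => by
    obtain ⟨H, A, f, g, hs, hA', hH⟩ := (hA.1 h).exists_hull hC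
    exact ⟨H, A, f, g, hs, hs.isHomExact hA', hA', hI.2 hH⟩
  tfae_have 7 → 6 := fun ⟨H, A, f, g, hs, _, h⟩ => ⟨H, A, f, g, hs, h⟩
  -- Tor_i(C, N) sits between Tor_{i+1}(C, A') = 0 and Tor_i(C, H') = 0; the latter holds because
  -- C-injectives lie in the Auslander class.
  tfae_have 6 → 4 := fun ⟨H, A, f, g, hs, hA', hH⟩ i hi =>
    (subsingleton_torC_iff (by lia)).2
      (hs.extZero_left₁ ((hIA (hI.1 hH)).extZero hi) (hA'.extZero (by lia)))
  tfae_finish
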